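/- All categories are locally small ordinary categories, of any size; ``lex'' means finite-limit preserving. A lex-weight is a functor $\phi\colon \mathcal K^{\mathrm{op}}\to\mathbf{Set}$ with $\mathcal K$ small and finitely complete. For a class $\Phi$ of lex-weights and a finitely complete category $\mathcal C$, let $\Phi\mathcal C$ be the smallest full replete subcategory of $[\mathcal C^{\mathrm{op}},\mathbf{Set}]$ that contains the representables and is closed under finite limits and under the weighted colimits $\phi\star D$ with $\phi\colon\mathcal K^{\mathrm{op}}\to\mathbf{Set}$ in $\Phi$ and $D$ a lex functor on $\mathcal K$ with values in the subcategory. Let $W\colon\mathcal C\to\Phi\mathcal C$ be the restricted Yoneda embedding. The category $\mathcal C$ is called $\Phi$-exact if $W$ has a lex left adjoint. Let $\mathcal K_{\mathrm{reg}}$ be the free category with finite limits generated by an arrow $f\colon X\to Y$, and let $\Phi_{\mathrm{reg}}$ consist of the single lex-weight on $\mathcal K_{\mathrm{reg}}$ given by the coequaliser in $[\mathcal K_{\mathrm{reg}}^{\mathrm{op}},\mathbf{Set}]$ of the kernel pair of $\mathcal K_{\mathrm{reg}}(-,f)$. Let $\mathcal K_{\mathrm{ex}}$ be the free category with finite limits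 generated by an equivalence relation $(s,t)\colon R\rightarrowtail X\times X$, and let $\Phi_{\mathrm{ex}}$ consist of the single lex-weight on $\mathcal K_{\mathrm{ex}}$ given by the coequaliser in $[\mathcal K_{\mathrm{ex}}^{\mathrm{op}},\mathbf{Set}]$ of $\mathcal K_{\mathrm{ex}}(-,s)$ and $\mathcal K_{\mathrm{ex}}(-,t)$. (Explicitly, $\mathcal K_{\mathrm{reg}}$ is the opposite of the category of maps of finite sets with generating arrow given by $(0\to1)\to(1\to1)$, and $\mathcal K_{\mathrm{ex}}$ is the opposite of the category of finite sets with an equivalence relation and relation-preserving functions, with generating equivalence relation given by the two maps from the one-element set to the two-element set with the total relation; that these have the stated universal properties, i.e. that for each finitely complete $\mathcal D$ evaluation at the generator gives an equivalence from lex functors into $\mathcal D$ to arrows, respectively equivalence relations, in $\mathcal D$, is part of the assertion.) Then for every finitely complete category $\mathcal C$: \begin{enumerate} \item $\mathcal C$ is $\Phi_{\mathrm{reg}}$-exact if and only if it is regular (it has coequalisers of kernel pairs, and regular epimorphisms are stable under pullback); \item $\mathcal C$ is $\Phi_{\mathrm{ex}}$-exact if and only if it is Barr-exact (it is regular and every equivalence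 relation in it is a kernel pair); \item $W\colon\mathcal C\to\Phi_{\mathrm{ex}}\mathcal C$ is the ex/lex completion of $\mathcal C$: $\Phi_{\mathrm{ex}}\mathcal C$ is Barr-exact, $W$ is lex, and for every Barr-exact category $\mathcal E$, restriction along $W$ is an equivalence from the category of exact functors (lex and preserving regular epimorphisms) $\Phi_{\mathrm{ex}}\mathcal C\to\mathcal E$ to the category of lex functors $\mathcal C\to\mathcal E$. \end{enumerate} -/

import Mathlib

open CategoryTheory CategoryTheory.Limits Opposite

universe v u v₁ u₁ v₂ u₂ w

namespace LexCol

/-! ## Barr-exact categories, exact functors and the ex/lex completion -/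

/-- A Barr-exact category: a regular category in which every (internal) equivalence relation is
effective, i.e. is the kernel pair of some morphism. -/
structure IsBarrExact (C : Type u) [Category.{v} C] : Prop extends Regular C where
  exists_isKernelPair : ∀ {R X : C} (s t : R ⟶ X), IsEquivalenceRelation s t →
    ∃ (Y : C) (q : X ⟶ Y), IsKernelPair q s t

/-- Exact functors between Barr-exact categories: those preserving finite limits and regular
epimorphisms. -/
def exactFunctorBarr (C : Type u₁) [Category.{v₁} C] (D : Type u₂) [Category.{v₂} D] :
    ObjectProperty (C ⥤ D) :=
  fun F => PreservesFiniteLimits F ∧ ∀ ⦃X Y : C⦄ (f : X ⟶ Y), IsRegularEpi f → IsRegularEpi (F.map f)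

/-- Restriction along a left exact functor `W : C ⥤ D`, from exact functors `D ⥤ E` (and arbitrary
natural transformations) to left exact functors `C ⥤ E`. -/
def restrictExact {C : Type u} [Category.{v} C] {D : Type u₁} [Category.{v₁} D]
    (W : C ⥤ D) (hW : PreservesFiniteLimits W) (E : Type u₂) [Category.{v₂} E] :
    (exactFunctorBarr D E).FullSubcategory ⥤ (C ⥤ₗ E) :=
  (leftExactFunctor C E).lift ((exactFunctorBarr D E).ι ⋙ (Functor.whiskeringLeft C D E).obj W)
    (fun F => by
      have := F.property.1
      exact (inferInstance : PreservesFiniteLimits (W ⋙ F.obj)))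

/-- `W : C ⥤ D` is the ex/lex completion of the finitely complete category `C`: `D` is Barr-exact,
`W` is left exact, and for every Barr-exact category `E` restriction along `W` is an equivalence
from the category of exact functors `D ⥤ E` to that of left exact functors `C ⥤ E`. -/
def IsExLexCompletion {C : Type u} [Category.{v} C] {D : Type u₁} [Category.{v₁} D]
    (W : C ⥤ D) : Prop :=
  IsBarrExact D ∧ ∃ hW : PreservesFiniteLimits W,
    ∀ (E : Type u₂) [Category.{v₂} E], IsBarrExact E → (restrictExact W hW E).IsEquivalence

/-! ## Lex-weights, the category `Φ C`, and `Φ`-exactness -/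

/-- A lex-weight: a presheaf on a small finitely complete category. The presheaf need not preserve
any limits. -/
structure LexWeight : Type (v + 1) where
  /-- the indexing category -/
  K : Type v
  [cat : SmallCategory K]
  [lex : HasFiniteLimits K]
  /-- the weight -/
  weight : Kᵒᵖ ⥤ Type v

attribute [instance] LexWeight.cat LexWeight.lex

/-- Cocones under `D : K ⥤ C` weighted by `φ : Kᵒᵖ ⥤ Type v`. As for weighted limits in Mathlib,
these are the cocones under the composite of `D` with the projection from the (opposite of the)
category of elements of `φ`; such a cocone with apex `Z` amounts to a natural transformation from
`φ` to `C(D -, Z)`. A colimiting such cocone exhibits its apex as the weighted colimit `φ ⋆ D`. -/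
abbrev WeightedCocone {K : Type u₁} [Category.{v₁} K] {C : Type u₂} [Category.{v₂} C]
    (φ : Kᵒᵖ ⥤ Type w) (D : K ⥤ C) :=
  Cocone ((CategoryOfElements.π φ).leftOp ⋙ D)

variable (Φ : Set LexWeight.{v}) (C : Type u) [Category.{v} C]

/-- A full replete subcategory `Q` of the category of presheaves on `C` contains the
representables and is closed under finite limits and under `Φ`-lex-colimits, i.e. under the
weighted colimits `φ ⋆ D` with `φ : Kᵒᵖ ⥤ Type v` in `Φ` and `D` a left exact functor on `K`. -/
structure IsLexClosed (Q : ObjectProperty (Cᵒᵖ ⥤ Type v)) : Prop where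
  of_iso : Q.IsClosedUnderIsomorphisms
  representable : ∀ X : C, Q (yoneda.obj X)
  finiteLimit : ∀ (J : Type) [SmallCategory J] [FinCategory J], Q.IsClosedUnderLimitsOfShape J
  lexColimit : ∀ φ ∈ Φ, ∀ D : φ.K ⥤ Cᵒᵖ ⥤ Type v, PreservesFiniteLimits D →
    (∀ k : φ.K, Q (D.obj k)) →
    ∀ c : WeightedCocone φ.weight D, Nonempty (IsColimit c) → Q c.pt

/-- The objects of `Φ C`: the closure of the representables under finite limits and
`Φ`-lex-colimits in presheaves. -/
def lexClosure : ObjectProperty (Cᵒᵖ ⥤ Type v) :=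
  fun P => ∀ Q : ObjectProperty (Cᵒᵖ ⥤ Type v), IsLexClosed Φ C Q → Q P

/-- The category `Φ C`. -/
abbrev Completion := (lexClosure Φ C).FullSubcategory

/-- The functor `W : C ⥤ Φ C`, the corestriction of the Yoneda embedding. -/
def W : C ⥤ Completion Φ C :=
  (lexClosure Φ C).lift yoneda (fun X _ hQ => hQ.representable X)

/-- A (finitely complete) category `C` is `Φ`-exact if `W : C ⥤ Φ C` has a left exact left
adjoint. -/
def IsPhiExact : Prop :=
  ∃ L : Completion Φ C ⥤ C, Nonempty (L ⊣ W Φ C) ∧ PreservesFiniteLimits L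

end LexCol

namespace LexCol

/-! ## The free category with finite limits on an arrow, and `Φ_reg` -/

/-- A lex category `K` is freely generated, as a category with finite limits, by the arrow `f`:
for every finitely complete `D`, evaluation at `f` is an equivalence from the category of left
exact functors `K ⥤ D` to the category of arrows of `D` (it is essentially surjective on objects,
and fully faithful). -/
structure IsFreeLexOnArrow {K : Type u} [Category.{v} K] {X Y : K} (f : X ⟶ Y) : Prop where
  exists_functor : ∀ (D : Type u₂) [Category.{v₂} D] [HasFiniteLimits D] {U V : D} (h : U ⟶ V),
    ∃ F : K ⥤ D, PreservesFiniteLimits F ∧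
      ∃ (a : F.obj X ≅ U) (b : F.obj Y ≅ V), F.map f ≫ b.hom = a.hom ≫ h
  existsUnique_hom : ∀ (D : Type u₂) [Category.{v₂} D] [HasFiniteLimits D] (F G : K ⥤ D),
    PreservesFiniteLimits F → PreservesFiniteLimits G →
    ∀ (a : F.obj X ⟶ G.obj X) (b : F.obj Y ⟶ G.obj Y), F.map f ≫ b = a ≫ G.map f →
      ∃! τ : F ⟶ G, τ.app X = a ∧ τ.app Y = b

/-- The free category with finite limits on an arrow, realised as the opposite of the category of
maps of finite sets, i.e. of the finitely presentable functors from the arrow category to sets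
(with the skeleton of finite sets, so as to be small). -/
abbrev KReg : Type v := (Arrow FintypeCat.Skeleton.{v})ᵒᵖ

instance hasFiniteColimits_skeleton : HasFiniteColimits FintypeCat.Skeleton.{v} where
  out _ _ _ :=
    Adjunction.hasColimitsOfShape_of_equivalence FintypeCat.Skeleton.equivalence.{v}.functor

/-- The domain of the generating arrow: the map of finite sets `1 ⟶ 1`, which represents
the functor taking a map of sets to its domain. -/
abbrev KReg.X : KReg.{v} := op (Arrow.mk (𝟙 (FintypeCat.Skeleton.mk 1)))

/-- The map of finite sets `0 ⟶ 1`. -/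
def emptyToOne : FintypeCat.Skeleton.mk.{v} 0 ⟶ FintypeCat.Skeleton.mk.{v} 1 :=
  fun x => Fin.elim0 x.down

/-- The codomain of the generating arrow: the map of finite sets `0 ⟶ 1`, which represents
the functor taking a map of sets to its codomain. -/
abbrev KReg.Y : KReg.{v} := op (Arrow.mk emptyToOne)

/-- The generating arrow. -/
def KReg.f : KReg.X.{v} ⟶ KReg.Y.{v} :=
  (Arrow.homMk emptyToOne (𝟙 _) rfl : Arrow.mk emptyToOne ⟶ Arrow.mk (𝟙 _)).op

/-- The weight of `Φ_reg`: the coequaliser in `[Kᵒᵖ, Set]` of the kernel pair of `K(-, f)`. -/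
noncomputable def regWeight : LexWeight.{v} where
  K := KReg.{v}
  weight := coequalizer
    (pullback.fst (yoneda.map KReg.f.{v}) (yoneda.map KReg.f.{v}))
    (pullback.snd (yoneda.map KReg.f.{v}) (yoneda.map KReg.f.{v}))

/-- The class of lex-weights `Φ_reg`. -/
def PhiReg : Set LexWeight.{v} := {regWeight.{v}}

end LexCol

namespace LexCol

/-! ## The free category with finite limits on an equivalence relation, and `Φ_ex` -/

/-- A lex category `K` is freely generated, as a category with finite limits, by the equivalence
relation `s, t : R ⟶ X`: this is an equivalence relation in `K`, and for every finitely complete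
`D`, evaluation at it is an equivalence from the category of left exact functors `K ⥤ D` to the
category of equivalence relations in `D` (it is essentially surjective on objects, and fully
faithful). -/
structure IsFreeLexOnEquivalenceRelation {K : Type u} [Category.{v} K] {R X : K}
    (s t : R ⟶ X) : Prop where
  isEquivalenceRelation : IsEquivalenceRelation s t
  exists_functor : ∀ (D : Type u₂) [Category.{v₂} D] [HasFiniteLimits D] {S U : D} (p q : S ⟶ U),
    IsEquivalenceRelation p q → ∃ F : K ⥤ D, PreservesFiniteLimits F ∧
      ∃ (a : F.obj R ≅ S) (b : F.obj X ≅ U),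
        F.map s ≫ b.hom = a.hom ≫ p ∧ F.map t ≫ b.hom = a.hom ≫ q
  existsUnique_hom : ∀ (D : Type u₂) [Category.{v₂} D] [HasFiniteLimits D] (F G : K ⥤ D),
    PreservesFiniteLimits F → PreservesFiniteLimits G →
    ∀ (a : F.obj R ⟶ G.obj R) (b : F.obj X ⟶ G.obj X),
      F.map s ≫ b = a ≫ G.map s → F.map t ≫ b = a ≫ G.map t →
      ∃! τ : F ⟶ G, τ.app R = a ∧ τ.app X = b

/-- Finite sets (from the skeleton) equipped with an equivalence relation. -/
structure FinSetoid : Type v where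
  /-- the underlying finite set -/
  carrier : FintypeCat.Skeleton.{v}
  /-- the equivalence relation -/
  rel : Setoid (ULift.{v} (Fin carrier.len))

namespace FinSetoid

/-- Morphisms of finite setoids: functions (not just up to equivalence) that preserve the
relation. -/
@[ext]
structure Hom (A B : FinSetoid.{v}) : Type v where
  /-- the underlying function -/
  map : A.carrier ⟶ B.carrier
  map_rel : ∀ x y, A.rel x y → B.rel (map x) (map y)

instance : SmallCategory FinSetoid.{v} where
  Hom := Hom
  id A := ⟨𝟙 _, fun _ _ h => h⟩
  comp f g := ⟨f.map ≫ g.map, fun x y h => g.map_rel _ _ (f.map_rel x y h)⟩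

@[ext]
lemma hom_ext {A B : FinSetoid.{v}} {f g : A ⟶ B} (h : f.map = g.map) : f = g := Hom.ext h

@[simp] lemma comp_map {A B D : FinSetoid.{v}} (f : A ⟶ B) (g : B ⟶ D) :
    (f ≫ g).map = f.map ≫ g.map := rfl

/-- The forgetful functor to finite sets. -/
def forget : FinSetoid.{v} ⥤ FintypeCat.Skeleton.{v} where
  obj A := A.carrier
  map f := f.map

instance : HasFiniteColimits FinSetoid.{v} where
  out J _ _ := by
    refine ⟨fun F => ?_⟩
    let c : Cocone (F ⋙ forget) := colimit.cocone _
    have hc : IsColimit c := colimit.isColimit _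
    let S : Set (Setoid (ULift.{v} (Fin c.pt.len))) :=
      {r | ∀ (j : J) (x y), (F.obj j).rel x y → r (c.ι.app j x) (c.ι.app j y)}
    let c' : Cocone F :=
      { pt := ⟨c.pt, sInf S⟩
        ι := { app := fun j => (⟨c.ι.app j, fun x y h r hr => hr j x y h⟩ : Hom _ _)
               naturality := fun i j f => hom_ext (c.ι.naturality f) } }
    refine ⟨⟨c', ?_⟩⟩
    refine
      { desc := fun s =>
          (⟨hc.desc (forget.mapCocone s), fun x y h => ?_⟩ : Hom c'.pt s.pt)
        fac := fun s j => hom_ext (hc.fac (forget.mapCocone s) j)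
        uniq := fun s m hm => hom_ext (hc.uniq (forget.mapCocone s) _
          (fun j => congrArg Hom.map (hm j))) }
    have key : Setoid.comap (hc.desc (forget.mapCocone s)) s.pt.rel ∈ S := by
      intro j x y hxy
      have e : ∀ z, hc.desc (forget.mapCocone s) (c.ι.app j z) = (s.ι.app j).map z := fun z =>
        congrFun (hc.fac (forget.mapCocone s) j) z
      change s.pt.rel (hc.desc (forget.mapCocone s) (c.ι.app j x))
        (hc.desc (forget.mapCocone s) (c.ι.app j y))
      have := (s.ι.app j).map_rel x y hxy
      rwa [← e x, ← e y] at this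
    exact h _ key

/-- The one-element setoid, which represents the underlying set. -/
def one : FinSetoid.{v} := ⟨FintypeCat.Skeleton.mk 1, ⊤⟩

/-- The setoid with two, equivalent, elements, which represents the set of equivalent pairs. -/
def two : FinSetoid.{v} := ⟨FintypeCat.Skeleton.mk 2, ⊤⟩

/-- The map of finite sets `1 ⟶ 2` selecting `i`. -/
def pointMap (i : Fin 2) : FintypeCat.Skeleton.mk.{v} 1 ⟶ FintypeCat.Skeleton.mk.{v} 2 :=
  fun _ => ULift.up i

/-- The map selecting an element of `two`. -/
def point (i : Fin 2) : one.{v} ⟶ two.{v} :=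
  (⟨pointMap i, fun _ _ _ => trivial⟩ : Hom one.{v} two.{v})

end FinSetoid

/-- The free category with finite limits on an equivalence relation, realised as the opposite of
the category of finite setoids. -/
abbrev KEx : Type v := FinSetoid.{v}ᵒᵖ

/-- The first projection of the generating equivalence relation. -/
def KEx.s : (op FinSetoid.two : KEx.{v}) ⟶ op FinSetoid.one := (FinSetoid.point 0).op

/-- The second projection of the generating equivalence relation. -/
def KEx.t : (op FinSetoid.two : KEx.{v}) ⟶ op FinSetoid.one := (FinSetoid.point 1).op

/-- The weight of `Φ_ex`: the coequaliser in `[Kᵒᵖ, Set]` of `K(-, s)` and `K(-, t)`. -/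
noncomputable def exWeight : LexWeight.{v} where
  K := KEx.{v}
  weight := coequalizer (yoneda.map KEx.s.{v}) (yoneda.map KEx.t.{v})

/-- The class of lex-weights `Φ_ex`. -/
def PhiEx : Set LexWeight.{v} := {exWeight.{v}}

end LexCol

/-!
Left exact functors and exact completions are compared through families of maps
`P X → E(F X, B)`, natural in `X`, where `P` is a presheaf on `C` and `F : C ⥤ E` is left exact with
values in a regular category. Such a family stands for a map from the left Kan extension of `P`
along `F` to the presheaf represented by `B`, but needs neither the Kan extension nor a comparison
of universes. It is a *local isomorphism* (`Family.IsLocalIso`) if it is bijective up to passing to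
covers by regular epimorphisms; then `B` is the sheafification of that Kan extension for the regular
topology of `E`, and the family is universal (`Family.IsLocalIso.exists_desc`). Call `P`
*realizable* if some local isomorphism starts at `P`. The realizable presheaves contain the
representables and are closed under finite limits, and choosing realizations gives a left exact
functor `extend F` to `E` that extends `F` and sends pointwise surjections to regular epimorphisms.
The quotient of a realizable presheaf by a realizable equivalence relation is realizable as soon as
`extend F` sends the relation to a kernel pair (`realizable_quotient`).

The weights of `Φ_reg` and `Φ_ex` are quotients of representables by the generic kernel pair and by
the generic equivalence relation, so that the colimits weighted by them are quotients of this kind.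
Left exact functors preserve kernel pairs; if `E` is Barr-exact, then all equivalence relations in
it are kernel pairs. Hence all objects of `Φ_reg C` are realizable for regular `E`, and all
objects of `Φ_ex C` are realizable for Barr-exact `E`. For `F` the identity of `C`, the functor
`extend F` is the left exact left adjoint of `W`. Conversely, the universal properties of the two
free categories show that `Φ_reg C` and `Φ_ex C` contain the images of all their maps, respectively
the quotients of all their equivalence relations, computed pointwise. So they are regular,
respectively Barr-exact, and this descends along a left exact reflection
(`regular_of_adjunction`, `isBarrExact_of_adjunction`).

For the ex/lex completion, `extend F` shows that restriction along `W` is essentially surjective.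
Realizing the presheaves in `Φ_ex C` along `W` itself shows that each of them is a quotient of a
representable (`exists_cover`). Representables are projective with respect to such quotients,
whence restriction along `W` is fully faithful (`existsUnique_whiskerLeft_eq`).

The universal properties of the two free categories rest on the codensity of their generators: each
object is a finite limit of copies of the two generating objects, so that transformations between
left exact functors are determined at the latter (`IsCodense.existsUnique_natTrans`). A left exact
functor with given values there is first found among functors to presheaves, where it sends a finite
structure `A` to the presheaf of homomorphisms from `A` to generalized elements, and then
corestricts to representables (`IsCodense.exists_functor`).
-/

namespace LexCol

/-! ### Covers in a regular category -/

section Covers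

variable {E : Type u₂} [Category.{v₂} E] [Regular E]

lemma isRegularEpi_of_strongEpi {X Y : E} (f : X ⟶ Y) [StrongEpi f] : IsRegularEpi f :=
  inferInstance

/-- A strong epimorphism can be pulled back along any map. -/
lemma exists_strongEpi_pullback {X Y Z : E} (e : X ⟶ Y) [StrongEpi e] (g : Z ⟶ Y) :
    ∃ (T : E) (e' : T ⟶ Z) (g' : T ⟶ X), StrongEpi e' ∧ e' ≫ g = g' ≫ e :=
  ⟨pullback g e, pullback.fst g e, pullback.snd g e, inferInstance, pullback.condition⟩

/-- Descent along a strong epimorphism of maps which agree on its kernel pair, the latter being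
tested by generalized elements, locally. -/
lemma exists_desc_of_strongEpi {X Y W : E} (e : X ⟶ Y) [StrongEpi e] (h : X ⟶ W)
    (H : ∀ {Z : E} (a b : Z ⟶ X), a ≫ e = b ≫ e →
      ∃ (T : E) (t : T ⟶ Z), Epi t ∧ t ≫ a ≫ h = t ≫ b ≫ h) :
    ∃ g : Y ⟶ W, e ≫ g = h := by
  refine IsRegularEpi.exists_of_isKernelPair e (IsKernelPair.of_hasPullback e) h ?_
  obtain ⟨T, t, ht, hh⟩ := H _ _ (pullback.condition (f := e) (g := e))
  exact (cancel_epi t).1 hh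

end Covers

/-! ### Families of maps out of a presheaf along a functor -/

section Families

variable {C : Type u} [Category.{v} C] {E : Type u₂} [Category.{v₂} E]

/-- A natural family of maps `P X → E(F X, B)`. If the left Kan extension of `P` along `F` exists,
this is a map from it to the presheaf represented by `B`; the present formulation makes sense
whatever the universes in which `P` and `E` live. -/
@[ext]
structure Family (F : C ⥤ E) (P : Cᵒᵖ ⥤ Type w) (B : E) where
  /-- the maps of the family -/
  app (X : C) (p : P.obj (op X)) : F.obj X ⟶ B
  naturality {X Y : C} (f : X ⟶ Y) (p : P.obj (op Y)) :
    app X (P.map f.op p) = F.map f ≫ app Y p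

namespace Family

variable {F : C ⥤ E} {P Q : Cᵒᵖ ⥤ Type w} {B B' B'' : E}

/-- Postcomposition of a family with a map of `E`. -/
@[simps]
def comp (θ : Family F P B) (g : B ⟶ B') : Family F P B' where
  app X p := θ.app X p ≫ g
  naturality f p := by simp [θ.naturality]

/-- Precomposition of a family with a map of presheaves. -/
@[simps]
def precomp (α : Q ⟶ P) (θ : Family F P B) : Family F Q B where
  app X q := θ.app X (α.app _ q)
  naturality f q := by rw [NatTrans.naturality_apply, θ.naturality]

/-- The universal family on a representable presheaf. -/
@[simps]
def ofYoneda (F : C ⥤ E) (A : C) : Family F (yoneda.obj A) (F.obj A) where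
  app X p := F.map p
  naturality f p := by simp

/-- A family is a local isomorphism if it is locally surjective and locally injective, where
"locally" means after passing to a strong (equivalently, regular) epimorphism of `E`. For `F` left
exact and `E` regular this says that the induced map from the Kan extension of `P` along `F` to the
presheaf represented by `B` is inverted by sheafification for the regular topology of `E`. -/
structure IsLocalIso (θ : Family F P B) : Prop where
  surj : ∀ {Z : E} (z : Z ⟶ B), ∃ (Z' : E) (e : Z' ⟶ Z) (X : C) (x : Z' ⟶ F.obj X)
    (p : P.obj (op X)), StrongEpi e ∧ x ≫ θ.app X p = e ≫ z
  inj : ∀ {Z : E} {X : C} (p p' : P.obj (op X)) (x : Z ⟶ F.obj X),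
    x ≫ θ.app X p = x ≫ θ.app X p' → ∃ (Z' : E) (e : Z' ⟶ Z) (X' : C) (f : X' ⟶ X)
    (x' : Z' ⟶ F.obj X'), StrongEpi e ∧ x' ≫ F.map f = e ≫ x ∧ P.map f.op p = P.map f.op p'

namespace IsLocalIso

variable {θ : Family F P B}

/-- Local injectivity for two elements over different objects. -/
lemma inj₂ [HasFiniteLimits C] [HasFiniteLimits E] [PreservesFiniteLimits F] (h : θ.IsLocalIso)
    {Z : E} {X Y : C} (p : P.obj (op X)) (q : P.obj (op Y)) (x : Z ⟶ F.obj X) (y : Z ⟶ F.obj Y)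
    (hxy : x ≫ θ.app X p = y ≫ θ.app Y q) :
    ∃ (Z' : E) (e : Z' ⟶ Z) (X' : C) (f : X' ⟶ X) (g : X' ⟶ Y) (x' : Z' ⟶ F.obj X'),
      StrongEpi e ∧ x' ≫ F.map f = e ≫ x ∧ x' ≫ F.map g = e ≫ y ∧
        P.map f.op p = P.map g.op q := by
  let z : Z ⟶ F.obj (X ⨯ Y) := prod.lift x y ≫ (PreservesLimitPair.iso F X Y).inv
  have z1 : z ≫ F.map prod.fst = x := by
    simpa [z] using prod.lift_fst x y
  have z2 : z ≫ F.map prod.snd = y := by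
    simpa [z] using prod.lift_snd x y
  obtain ⟨Z', e, X', f, x', he, hf, hp⟩ :=
    h.inj (P.map (prod.fst : X ⨯ Y ⟶ X).op p) (P.map (prod.snd : X ⨯ Y ⟶ Y).op q) z (by
      rw [θ.naturality, θ.naturality, reassoc_of% z1, reassoc_of% z2, hxy])
  refine ⟨Z', e, X', f ≫ prod.fst, f ≫ prod.snd, x', he, ?_, ?_, ?_⟩
  · rw [F.map_comp, reassoc_of% hf, z1]
  · rw [F.map_comp, reassoc_of% hf, z2]
  · simpa using hp

lemma hom_ext (h : θ.IsLocalIso) {g g' : B ⟶ B'} (hg : θ.comp g = θ.comp g') :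
    g = g' := by
  obtain ⟨Z, e, X, x, p, he, hx⟩ := h.surj (𝟙 B)
  rw [← cancel_epi e]
  rw [Category.comp_id] at hx
  have := congrArg (fun φ : Family F P B' => φ.app X p) hg
  simp only [comp_app] at this
  rw [← hx, Category.assoc, Category.assoc, this]

lemma precomp_iso (h : θ.IsLocalIso) (α : Q ≅ P) : (precomp α.hom θ).IsLocalIso where
  surj z := by
    obtain ⟨Z', e, X, x, p, he, hx⟩ := h.surj z
    exact ⟨Z', e, X, x, α.inv.app _ p, he, by simpa using hx⟩
  inj p p' x hx := by
    obtain ⟨Z', e, X', f, x', he, hf, hp⟩ := h.inj _ _ x hx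
    refine ⟨Z', e, X', f, x', he, hf, ?_⟩
    have := congrArg (α.inv.app _) hp
    simpa [← NatTrans.naturality_apply] using this

/-- The representing object of a locally isomorphic family is covered by a single element. -/
lemma exists_cover (h : θ.IsLocalIso) :
    ∃ (X : C) (p : P.obj (op X)), StrongEpi (θ.app X p) := by
  obtain ⟨Z, e, X, x, p, he, hx⟩ := h.surj (𝟙 B)
  refine ⟨X, p, ?_⟩
  rw [Category.comp_id] at hx
  have : StrongEpi (x ≫ θ.app X p) := by rwa [hx]
  exact strongEpi_of_strongEpi x _

variable [HasFiniteLimits C] [Regular E] [PreservesFiniteLimits F]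

/-- The universal property of locally isomorphic families. -/
lemma exists_desc (h : θ.IsLocalIso) (θ' : Family F P B') : ∃ g : B ⟶ B', θ.comp g = θ' := by
  obtain ⟨X, p, hp⟩ := h.exists_cover
  obtain ⟨g, hg⟩ := exists_desc_of_strongEpi (θ.app X p) (θ'.app X p) (by
    intro Z a b hab
    obtain ⟨Z', e, X', f, f', x', he, hf, hf', hpp⟩ := h.inj₂ p p a b hab
    refine ⟨Z', e, inferInstance, ?_⟩
    rw [← reassoc_of% hf, ← reassoc_of% hf', ← θ'.naturality, ← θ'.naturality, hpp])
  refine ⟨g, ?_⟩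
  ext Y q
  obtain ⟨T, t, y, ht, hty⟩ := exists_strongEpi_pullback (θ.app X p) (θ.app Y q)
  obtain ⟨Z', e, X', f, f', x', he, hf, hf', hpp⟩ := h.inj₂ q p t y hty
  have : StrongEpi (e ≫ t) := inferInstance
  rw [← cancel_epi (e ≫ t)]
  simp only [comp_app, Category.assoc]
  rw [reassoc_of% hty, hg, ← reassoc_of% hf, ← reassoc_of% hf', ← θ'.naturality, ← θ'.naturality,
    hpp]

/-- The comparison between the representing objects of two locally isomorphic families. -/
lemma isIso_of_comp (h : θ.IsLocalIso) (g : B ⟶ B') (h' : (θ.comp g).IsLocalIso) : IsIso g := by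
  obtain ⟨k, hk⟩ := h'.exists_desc θ
  refine ⟨k, h.hom_ext ?_, h'.hom_ext ?_⟩
  · ext X p
    have := congrArg (fun φ : Family F P B => φ.app X p) hk
    simpa using this
  · ext X p
    have := congrArg (fun φ : Family F P B => φ.app X p) hk
    simp only [comp_app, Category.assoc] at this
    simp [reassoc_of% this]

end IsLocalIso

lemma isLocalIso_ofYoneda [HasFiniteLimits C] [PreservesFiniteLimits F] (A : C) :
    (ofYoneda F A).IsLocalIso where
  surj {Z} z := ⟨Z, 𝟙 Z, A, z, 𝟙 A, inferInstance, by simp⟩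
  inj {Z X} p p' x hx := by
    change X ⟶ A at p
    change X ⟶ A at p'
    have hl := isLimitForkMapOfIsLimit F (equalizer.condition p p') (equalizerIsEqualizer p p')
    obtain ⟨l, hl⟩ := Fork.IsLimit.lift' hl x hx
    exact ⟨Z, 𝟙 Z, equalizer p p', equalizer.ι p p', l, inferInstance, by simpa using hl,
      by simpa using equalizer.condition p p'⟩

end Family

end Families

/-! ### Closure under finite limits -/

section Closure

variable {A : Type u₁} [Category.{v₁} A]

/-- A replete full subcategory that contains the terminal object and is closed under pullbacks is
closed under all finite limits. -/
lemma isClosedUnderLimitsOfShape_of_terminal_of_pullback [HasFiniteLimits A]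
    (Q : ObjectProperty A) [Q.IsClosedUnderIsomorphisms] (hT : Q (⊤_ A))
    (hP : ∀ {P X Y Z : A} {a : P ⟶ X} {b : P ⟶ Y} {f : X ⟶ Z} {g : Y ⟶ Z},
      IsPullback a b f g → Q X → Q Y → Q Z → Q P)
    (J : Type) [SmallCategory J] [FinCategory J] : Q.IsClosedUnderLimitsOfShape J := by
  have h1 : Q.IsClosedUnderLimitsOfShape (Discrete.{0} PEmpty) := .mk' (by
    rintro _ ⟨G, _⟩
    have e : limit G ≅ ⊤_ A := HasLimit.isoOfNatIso (Functor.emptyExt _ _)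
    exact Q.prop_of_iso e.symm hT)
  have h2 : Q.IsClosedUnderLimitsOfShape WalkingCospan := .mk' (by
    rintro _ ⟨G, hG⟩
    have e : limit G ≅ pullback (G.map WalkingCospan.Hom.inl) (G.map WalkingCospan.Hom.inr) :=
      HasLimit.isoOfNatIso (diagramIsoCospan G)
    exact Q.prop_of_iso e.symm (hP (IsPullback.of_hasPullback _ _) (hG _) (hG _) (hG _)))
  have : HasTerminal Q.FullSubcategory := hasLimitsOfShape_of_closedUnderLimits _ _
  have : HasPullbacks Q.FullSubcategory := hasLimitsOfShape_of_closedUnderLimits _ _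
  have : HasFiniteLimits Q.FullSubcategory := hasFiniteLimits_of_hasTerminal_and_pullbacks
  have : PreservesFiniteLimits Q.ι := preservesFiniteLimits_of_preservesTerminal_and_pullbacks _
  exact Q.isClosedUnderLimitsOfShape_of_preservesLimitsOfShape_ι J

variable (Q : ObjectProperty A) [HasFiniteLimits A]

lemma hasFiniteLimits_fullSubcategory
    (h : ∀ (J : Type) [SmallCategory J] [FinCategory J], Q.IsClosedUnderLimitsOfShape J) :
    HasFiniteLimits Q.FullSubcategory where
  out J _ _ := have := h J; inferInstance

lemma preservesFiniteLimits_ι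
    (h : ∀ (J : Type) [SmallCategory J] [FinCategory J], Q.IsClosedUnderLimitsOfShape J) :
    PreservesFiniteLimits Q.ι where
  preservesFiniteLimits J _ _ := have := h J; inferInstance

end Closure

/-! ### Limits and quotients of presheaves, in terms of elements -/

section Presheaf

variable {C : Type u} [Category.{v} C] {R P X Y Z : Cᵒᵖ ⥤ Type w}

/-- The quotient of a presheaf by an equivalence relation: the coequalizer is computed by the
quotients of the values. -/
structure IsQuotient (s t : R ⟶ P) (q : P ⟶ X) : Prop where
  w : s ≫ q = t ≫ q
  surj : ∀ U, Function.Surjective (q.app U)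
  exists_rel : ∀ {U} (x y : P.obj U), q.app U x = q.app U y →
    ∃ r : R.obj U, s.app U r = x ∧ t.app U r = y

lemma isEquivalenceRelation_map {A : Type u₁} [Category.{v₁} A] {D : Type u₂} [Category.{v₂} D]
    (F : A ⥤ D) [HasFiniteLimits A] [PreservesFiniteLimits F] {R X : A} {s t : R ⟶ X}
    (h : IsEquivalenceRelation s t) : IsEquivalenceRelation (F.map s) (F.map t) := by
  obtain ⟨⟨e⟩⟩ := h
  have : JointlyMono₂ (F.map s) (F.map t) := by
    have hm : Mono (prod.lift s t) := ⟨fun a b hab => by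
      have h1 := congrArg (· ≫ prod.fst) hab
      have h2 := congrArg (· ≫ prod.snd) hab
      simp only [Category.assoc] at h1 h2
      rw [prod.lift_fst] at h1
      rw [prod.lift_snd] at h2
      exact e.right_cancellation a b h1 h2⟩
    refine ⟨fun Z a b h1 h2 => ?_⟩
    rw [← cancel_mono (F.map (prod.lift s t))]
    refine BinaryFan.IsLimit.hom_ext
      (mapIsLimitOfPreservesOfIsLimit F prod.fst prod.snd (prodIsProd X X)) ?_ ?_
    · change (a ≫ F.map _) ≫ F.map prod.fst = (b ≫ F.map _) ≫ F.map prod.fst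
      rwa [Category.assoc, Category.assoc, ← F.map_comp, prod.lift_fst]
    · change (a ≫ F.map _) ≫ F.map prod.snd = (b ≫ F.map _) ≫ F.map prod.snd
      rwa [Category.assoc, Category.assoc, ← F.map_comp, prod.lift_snd]
  exact EquivalenceRelation.isEquivalenceRelation
    { e.toReflexiveRelation.map F, e.toSymmetricRelation.map F, e.toTransitiveRelation.map F with }

lemma isQuotient_of_isColimit {s t : R ⟶ P} (h : IsEquivalenceRelation s t) {q : P ⟶ X}
    (w : s ≫ q = t ≫ q) (hq : IsColimit (Cofork.ofπ q w)) : IsQuotient s t q where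
  w := w
  surj U := by
    have : Epi q := Cofork.IsColimit.epi hq
    exact (epi_iff_surjective _).1 (inferInstance : Epi (q.app U))
  exists_rel {U} x y hxy := by
    have hU : IsEquivalenceRelation (s.app U) (t.app U) :=
      isEquivalenceRelation_map ((evaluation _ _).obj U) h
    obtain ⟨⟨e⟩⟩ := hU
    have heq := TypeCat.equivalence_of_equivalenceRelation e
    have wU : s.app U ≫ q.app U = t.app U ≫ q.app U := by
      rw [← NatTrans.comp_app, w, NatTrans.comp_app]
    have hqU : IsColimit (Cofork.ofπ (q.app U) wU) :=
      isColimitCoforkMapOfIsColimit ((evaluation _ _).obj U) w hq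
    have hx := Types.coequalizer_preimage_image_eq_of_preimage_eq _ _ (q.app U) wU hqU
      {z | TypeCat.Rel.ofPair (s.app U) (t.app U) x z} (by
        ext r
        simp only [Set.mem_preimage, Set.mem_ofPred_eq]
        exact ⟨fun h' => heq.trans h' ⟨r, rfl, rfl⟩,
          fun h' => heq.trans h' (heq.symm ⟨r, rfl, rfl⟩)⟩)
    have : y ∈ (q.app U) ⁻¹' ((q.app U) '' {z | TypeCat.Rel.ofPair (s.app U) (t.app U) x z}) :=
      ⟨x, heq.refl x, hxy⟩
    rw [hx] at this
    exact this

end Presheaf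

/-! ### The presheaves that have a realization, and their reflection -/

section Realizable

variable {C : Type u} [Category.{v} C] {E : Type u₂} [Category.{v₂} E]

/-- The presheaves `P` with a locally isomorphic family `P X → E(F X, B)` for some object `B`. -/
def realizable (F : C ⥤ E) : ObjectProperty (Cᵒᵖ ⥤ Type w) :=
  fun P => ∃ (B : E) (θ : Family F P B), θ.IsLocalIso

variable (F : C ⥤ E)

instance : (realizable.{v, u, v₂, u₂, w} F).IsClosedUnderIsomorphisms where
  of_iso := by
    rintro P Q e ⟨B, θ, h⟩
    exact ⟨B, _, h.precomp_iso e.symm⟩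

lemma realizable_yoneda [HasFiniteLimits C] [PreservesFiniteLimits F] (A : C) :
    realizable F (yoneda.obj A) := ⟨_, _, Family.isLocalIso_ofYoneda A⟩

variable {F}

/-- Locally isomorphic families are stable under pullback. -/
lemma Family.isLocalIso_of_isPullback [Regular E] {P P₁ P₂ P₀ : Cᵒᵖ ⥤ Type w}
    {a : P ⟶ P₁} {b : P ⟶ P₂} {f : P₁ ⟶ P₀} {g : P₂ ⟶ P₀} (h : IsPullback a b f g)
    [HasFiniteLimits C] [PreservesFiniteLimits F]
    {B B₁ B₂ B₀ : E} {a' : B ⟶ B₁} {b' : B ⟶ B₂} {f' : B₁ ⟶ B₀} {g' : B₂ ⟶ B₀}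
    (h' : IsPullback a' b' f' g')
    {θ : Family F P B} {θ₁ : Family F P₁ B₁} {θ₂ : Family F P₂ B₂} {θ₀ : Family F P₀ B₀}
    (ha : θ.comp a' = θ₁.precomp a) (hb : θ.comp b' = θ₂.precomp b)
    (hf : θ₁.comp f' = θ₀.precomp f) (hg : θ₂.comp g' = θ₀.precomp g)
    (h₁ : θ₁.IsLocalIso) (h₂ : θ₂.IsLocalIso) (h₀ : θ₀.IsLocalIso) : θ.IsLocalIso := by
  have ha' : ∀ X p, θ.app X p ≫ a' = θ₁.app X (a.app _ p) := fun X p =>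
    congrArg (fun φ : Family F P B₁ => φ.app X p) ha
  have hb' : ∀ X p, θ.app X p ≫ b' = θ₂.app X (b.app _ p) := fun X p =>
    congrArg (fun φ : Family F P B₂ => φ.app X p) hb
  have hf' : ∀ X p, θ₁.app X p ≫ f' = θ₀.app X (f.app _ p) := fun X p =>
    congrArg (fun φ : Family F P₁ B₀ => φ.app X p) hf
  have hg' : ∀ X p, θ₂.app X p ≫ g' = θ₀.app X (g.app _ p) := fun X p =>
    congrArg (fun φ : Family F P₂ B₀ => φ.app X p) hg
  constructor
  · intro Z z
    obtain ⟨Z₁, e₁, X₁, x₁, p₁, he₁, hx₁⟩ := h₁.surj (z ≫ a')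
    obtain ⟨Z₂, e₂, X₂, x₂, p₂, he₂, hx₂⟩ := h₂.surj (e₁ ≫ z ≫ b')
    obtain ⟨Z₃, e₃, X, u₁, u₂, x, he₃, hu₁, hu₂, hp⟩ :=
      h₀.inj₂ (f.app _ p₁) (g.app _ p₂) (e₂ ≫ x₁) x₂ (by
        rw [← hf', ← hg', Category.assoc, reassoc_of% hx₁, reassoc_of% hx₂, h'.w])
    obtain ⟨p, hp₁, hp₂⟩ := Types.exists_of_isPullback (h.app (op X))
      (P₁.map u₁.op p₁) (P₂.map u₂.op p₂) (by
        rw [NatTrans.naturality_apply, NatTrans.naturality_apply, hp])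
    refine ⟨Z₃, e₃ ≫ e₂ ≫ e₁, X, x, p, inferInstance, ?_⟩
    apply h'.hom_ext
    · simp only [Category.assoc]
      rw [ha', hp₁, θ₁.naturality, reassoc_of% hu₁, hx₁]
    · simp only [Category.assoc]
      rw [hb', hp₂, θ₂.naturality, reassoc_of% hu₂, hx₂]
  · intro Z X p p' x hx
    obtain ⟨Z₁, e₁, X₁, u₁, x₁, he₁, hu₁, hp₁⟩ := h₁.inj (a.app _ p) (a.app _ p') x (by
      rw [← ha', ← ha', reassoc_of% hx])
    obtain ⟨Z₂, e₂, X₂, u₂, x₂, he₂, hu₂, hp₂⟩ :=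
      h₂.inj (b.app _ (P.map u₁.op p)) (b.app _ (P.map u₁.op p')) x₁ (by
        rw [← hb', ← hb', θ.naturality, θ.naturality, Category.assoc, Category.assoc,
          reassoc_of% hu₁, reassoc_of% hu₁, reassoc_of% hx])
    refine ⟨Z₂, e₂ ≫ e₁, X₂, u₂ ≫ u₁, x₂, inferInstance, ?_, ?_⟩
    · rw [F.map_comp, reassoc_of% hu₂, hu₁, Category.assoc]
    · refine Types.ext_of_isPullback (h.app _) ?_ ?_
      · rw [NatTrans.naturality_apply, NatTrans.naturality_apply, op_comp, Functor.map_comp_apply,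
          Functor.map_comp_apply, hp₁]
      · rw [op_comp, Functor.map_comp_apply, Functor.map_comp_apply,
        NatTrans.naturality_apply b u₂.op,
          NatTrans.naturality_apply b u₂.op, hp₂]

/-- The family on a pullback of presheaves induced by families on its vertices. -/
lemma Family.exists_lift {P P₁ P₂ P₀ : Cᵒᵖ ⥤ Type w}
    {a : P ⟶ P₁} {b : P ⟶ P₂} {f : P₁ ⟶ P₀} {g : P₂ ⟶ P₀} (h : a ≫ f = b ≫ g)
    {B B₁ B₂ B₀ : E} {a' : B ⟶ B₁} {b' : B ⟶ B₂} {f' : B₁ ⟶ B₀} {g' : B₂ ⟶ B₀}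
    (h' : IsPullback a' b' f' g')
    {θ₁ : Family F P₁ B₁} {θ₂ : Family F P₂ B₂} {θ₀ : Family F P₀ B₀}
    (hf : θ₁.comp f' = θ₀.precomp f) (hg : θ₂.comp g' = θ₀.precomp g) :
    ∃ θ : Family F P B, θ.comp a' = θ₁.precomp a ∧ θ.comp b' = θ₂.precomp b := by
  have hf' : ∀ X p, θ₁.app X p ≫ f' = θ₀.app X (f.app _ p) := fun X p =>
    congrArg (fun φ : Family F P₁ B₀ => φ.app X p) hf
  have hg' : ∀ X p, θ₂.app X p ≫ g' = θ₀.app X (g.app _ p) := fun X p =>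
    congrArg (fun φ : Family F P₂ B₀ => φ.app X p) hg
  refine ⟨⟨fun X p => h'.lift (θ₁.app X (a.app _ p)) (θ₂.app X (b.app _ p)) ?_, ?_⟩, ?_, ?_⟩
  · rw [hf', hg', ← NatTrans.comp_app_apply, ← NatTrans.comp_app_apply, h]
  · intro X Y u p
    apply h'.hom_ext
    · simp only [IsPullback.lift_fst, Category.assoc]
      rw [NatTrans.naturality_apply, θ₁.naturality]
    · simp only [IsPullback.lift_snd, Category.assoc]
      rw [NatTrans.naturality_apply, θ₂.naturality]
  · ext X p
    simp
  · ext X p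
    simp

/-- The terminal presheaf is realized by the terminal object. -/
lemma Family.isLocalIso_of_isTerminal [HasFiniteLimits C] [PreservesFiniteLimits F]
    {P : Cᵒᵖ ⥤ Type w} (hP : IsTerminal P) {B : E} (hB : IsTerminal B) (θ : Family F P B) :
    θ.IsLocalIso := by
  have hU : ∀ U, IsTerminal (P.obj U) := fun U => hP.isTerminalObj ((evaluation _ _).obj U)
  have hF : IsTerminal (F.obj (⊤_ C)) := terminalIsTerminal.isTerminalObj F
  constructor
  · intro Z z
    exact ⟨Z, 𝟙 Z, ⊤_ C, hF.from Z, (hU _).from PUnit PUnit.unit, inferInstance,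
      hB.hom_ext _ _⟩
  · intro Z X p p' x hx
    exact ⟨Z, 𝟙 Z, X, 𝟙 X, x, inferInstance, by simp, congrArg _ <|
      ConcreteCategory.congr_hom ((hU _).hom_ext (↾fun _ : PUnit => p) (↾fun _ => p')) PUnit.unit⟩

section Extend

variable (F)

/-- The object of `E` that realizes a realizable presheaf. -/
noncomputable def realization (P : (realizable.{v, u, v₂, u₂, w} F).FullSubcategory) : E :=
  Exists.choose (show ∃ (B : E) (θ : Family F P.obj B), θ.IsLocalIso from P.property)

/-- The chosen locally isomorphic family on a realizable presheaf. -/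
noncomputable def realizationFamily (P : (realizable.{v, u, v₂, u₂, w} F).FullSubcategory) :
    Family F P.obj (realization F P) :=
  (Exists.choose_spec
    (show ∃ (B : E) (θ : Family F P.obj B), θ.IsLocalIso from P.property)).choose

lemma isLocalIso_realizationFamily (P : (realizable.{v, u, v₂, u₂, w} F).FullSubcategory) :
    (realizationFamily F P).IsLocalIso :=
  (Exists.choose_spec
    (show ∃ (B : E) (θ : Family F P.obj B), θ.IsLocalIso from P.property)).choose_spec

variable [HasFiniteLimits C] [Regular E] [PreservesFiniteLimits F]

/-- The extension of a left exact functor `F : C ⥤ E` to the realizable presheaves on `C`. -/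
noncomputable def extend : (realizable.{v, u, v₂, u₂, w} F).FullSubcategory ⥤ E where
  obj P := realization F P
  map {P Q} f := ((isLocalIso_realizationFamily F P).exists_desc
    ((realizationFamily F Q).precomp f.hom)).choose
  map_id P := (isLocalIso_realizationFamily F P).hom_ext (by
    rw [((isLocalIso_realizationFamily F P).exists_desc _).choose_spec]
    ext; simp)
  map_comp {P Q S} f g := (isLocalIso_realizationFamily F P).hom_ext (by
    rw [((isLocalIso_realizationFamily F P).exists_desc _).choose_spec]
    have h1 := ((isLocalIso_realizationFamily F P).exists_desc
      ((realizationFamily F Q).precomp f.hom)).choose_spec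
    have h2 := ((isLocalIso_realizationFamily F Q).exists_desc
      ((realizationFamily F S).precomp g.hom)).choose_spec
    ext X p
    have h1' := congrArg (fun φ => Family.app φ X p) h1
    have h2' := congrArg (fun φ => Family.app φ X (f.hom.app _ p)) h2
    simp only [Family.comp_app, Family.precomp_app] at h1' h2' ⊢
    rw [reassoc_of% h1', h2']
    simp)

/-- The universal family from a realizable presheaf to the value of the extension at it. -/
noncomputable def unit (P : (realizable.{v, u, v₂, u₂, w} F).FullSubcategory) :
    Family F P.obj ((extend F).obj P) := realizationFamily F P

lemma unit_isLocalIso (P : (realizable.{v, u, v₂, u₂, w} F).FullSubcategory) :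
    (unit F P).IsLocalIso := isLocalIso_realizationFamily F P

lemma unit_comp_map {P Q : (realizable.{v, u, v₂, u₂, w} F).FullSubcategory} (f : P ⟶ Q) :
    (unit F P).comp ((extend F).map f) = (unit F Q).precomp f.hom :=
  ((unit_isLocalIso F P).exists_desc ((unit F Q).precomp f.hom)).choose_spec

lemma unit_app_map {P Q : (realizable.{v, u, v₂, u₂, w} F).FullSubcategory} (f : P ⟶ Q) (X : C)
    (p : P.obj.obj (op X)) :
    (unit F P).app X p ≫ (extend F).map f = (unit F Q).app X (f.hom.app _ p) :=
  congrArg (fun φ => Family.app φ X p) (unit_comp_map F f)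

lemma unit_app_map_assoc {P Q : (realizable.{v, u, v₂, u₂, w} F).FullSubcategory} (f : P ⟶ Q)
    (X : C) (p : P.obj.obj (op X)) {Z : E} (h : (extend F).obj Q ⟶ Z) :
    (unit F P).app X p ≫ (extend F).map f ≫ h = (unit F Q).app X (f.hom.app _ p) ≫ h := by
  rw [← Category.assoc, unit_app_map]

lemma realizable_limits (J : Type) [SmallCategory J] [FinCategory J] :
    (realizable.{v, u, v₂, u₂, w} F).IsClosedUnderLimitsOfShape J := by
  refine isClosedUnderLimitsOfShape_of_terminal_of_pullback _ ?_ ?_ J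
  · exact ⟨⊤_ E, ⟨fun X p => terminal.from _, fun _ _ => terminal.hom_ext _ _⟩,
      Family.isLocalIso_of_isTerminal terminalIsTerminal terminalIsTerminal _⟩
  · intro P X Y Z a b f g h hX hY hZ
    let f' : (⟨X, hX⟩ : (realizable F).FullSubcategory) ⟶ ⟨Z, hZ⟩ := ObjectProperty.homMk f
    let g' : (⟨Y, hY⟩ : (realizable F).FullSubcategory) ⟶ ⟨Z, hZ⟩ := ObjectProperty.homMk g
    have h' := IsPullback.of_hasPullback ((extend F).map f') ((extend F).map g')
    obtain ⟨θ, ha, hb⟩ := Family.exists_lift h.w h' (unit_comp_map F f') (unit_comp_map F g')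
    exact ⟨_, θ, Family.isLocalIso_of_isPullback h h' ha hb (unit_comp_map F f')
      (unit_comp_map F g') (unit_isLocalIso F _) (unit_isLocalIso F _) (unit_isLocalIso F _)⟩

instance : HasFiniteLimits (realizable.{v, u, v₂, u₂, w} F).FullSubcategory :=
  hasFiniteLimits_fullSubcategory _ (realizable_limits F)

instance : PreservesFiniteLimits (realizable.{v, u, v₂, u₂, w} F).ι :=
  preservesFiniteLimits_ι _ (realizable_limits F)

lemma isPullback_extend {P P₁ P₂ P₀ : (realizable.{v, u, v₂, u₂, w} F).FullSubcategory}
    {a : P ⟶ P₁} {b : P ⟶ P₂} {f : P₁ ⟶ P₀} {g : P₂ ⟶ P₀} (h : IsPullback a b f g) :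
    IsPullback ((extend F).map a) ((extend F).map b) ((extend F).map f) ((extend F).map g) := by
  have hι : IsPullback a.hom b.hom f.hom g.hom := h.map (realizable F).ι
  have h' := IsPullback.of_hasPullback ((extend F).map f) ((extend F).map g)
  have w : (extend F).map a ≫ (extend F).map f = (extend F).map b ≫ (extend F).map g := by
    rw [← Functor.map_comp, h.w, Functor.map_comp]
  have hθ : ((unit F P).comp (h'.lift _ _ w)).IsLocalIso :=
    Family.isLocalIso_of_isPullback hι h'
      (by rw [← unit_comp_map]; ext; simp) (by rw [← unit_comp_map]; ext; simp)
      (unit_comp_map F f) (unit_comp_map F g)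
      (unit_isLocalIso F _) (unit_isLocalIso F _) (unit_isLocalIso F _)
  have : IsIso (h'.lift _ _ w) := (unit_isLocalIso F P).isIso_of_comp _ hθ
  exact IsPullback.of_iso_pullback ⟨w⟩ (asIso (h'.lift _ _ w)) (h'.lift_fst _ _ w)
    (h'.lift_snd _ _ w)

instance : PreservesFiniteLimits (extend.{v, u, v₂, u₂, w} F) := by
  have : PreservesLimitsOfShape WalkingCospan (extend.{v, u, v₂, u₂, w} F) := by
    refine ⟨fun {K} => ?_⟩
    suffices PreservesLimit (cospan (K.map WalkingCospan.Hom.inl) (K.map WalkingCospan.Hom.inr))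
        (extend.{v, u, v₂, u₂, w} F) from
      preservesLimit_of_iso_diagram _ (diagramIsoCospan K).symm
    have h := IsPullback.of_hasPullback (K.map WalkingCospan.Hom.inl) (K.map WalkingCospan.Hom.inr)
    exact preservesLimit_of_preserves_limit_cone h.isLimit
      ((isLimitMapConePullbackConeEquiv _ h.w).symm (isPullback_extend F h).isLimit)
  have : PreservesLimitsOfShape (Discrete.{0} PEmpty) (extend.{v, u, v₂, u₂, w} F) := by
    have hθ : ((unit F (⊤_ _)).comp (terminal.from _)).IsLocalIso :=
      Family.isLocalIso_of_isTerminal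
        (terminalIsTerminal.isTerminalObj (realizable.{v, u, v₂, u₂, w} F).ι) terminalIsTerminal _
    have := (unit_isLocalIso F (⊤_ _)).isIso_of_comp _ hθ
    have := preservesTerminal_of_isIso (extend.{v, u, v₂, u₂, w} F) (terminal.from _)
    exact preservesLimitsOfShape_pempty_of_preservesTerminal _
  exact preservesFiniteLimits_of_preservesTerminal_and_pullbacks _

/-- The extension sends pointwise surjections to regular epimorphisms. -/
lemma strongEpi_extend_map {P Q : (realizable.{v, u, v₂, u₂, w} F).FullSubcategory} (f : P ⟶ Q)
    (hf : ∀ U, Function.Surjective (f.hom.app U)) : StrongEpi ((extend F).map f) := by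
  obtain ⟨X, q, hq⟩ := (unit_isLocalIso F Q).exists_cover
  obtain ⟨p, rfl⟩ := hf _ q
  rw [← unit_app_map] at hq
  exact strongEpi_of_strongEpi ((unit F P).app X p) ((extend F).map f)

/-- The quotient of a realizable presheaf by a realizable equivalence relation is realizable,
provided that the extension sends the relation to a kernel pair. -/
lemma realizable_quotient {R P : (realizable.{v, u, v₂, u₂, w} F).FullSubcategory} {s t : R ⟶ P}
    {X : Cᵒᵖ ⥤ Type w} {q : P.obj ⟶ X} (hq : IsQuotient s.hom t.hom q)
    {B : E} {k : (extend F).obj P ⟶ B}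
    (hk : IsKernelPair k ((extend F).map s) ((extend F).map t)) : realizable F X := by
  wlog hk' : StrongEpi k generalizing B
  · refine this (B := (Regular.strongEpiMonoFactorisation k).I)
      (k := (Regular.strongEpiMonoFactorisation k).e) ?_ inferInstance
    have hk2 : IsKernelPair ((Regular.strongEpiMonoFactorisation k).e ≫
      (Regular.strongEpiMonoFactorisation k).m) ((extend F).map s) ((extend F).map t) := by simpa
    exact hk2.cancel_right_of_mono
  -- the value of the induced family does not depend on the choice of a preimage under `q`
  have key : ∀ {A : C} (x y : P.obj.obj (op A)), q.app _ x = q.app _ y →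
      (unit F P).app A x ≫ k = (unit F P).app A y ≫ k := by
    intro A x y hxy
    obtain ⟨r, rfl, rfl⟩ := hq.exists_rel x y hxy
    rw [← unit_app_map, ← unit_app_map, Category.assoc, Category.assoc, hk.w]
  let θ : Family F X B :=
    { app := fun A x => (unit F P).app A (hq.surj _ x).choose ≫ k
      naturality := fun {A A'} f x => by
        rw [← Category.assoc, ← (unit F P).naturality]
        apply key
        rw [(hq.surj _ _).choose_spec, NatTrans.naturality_apply, (hq.surj _ _).choose_spec] }
  have hθ : ∀ A (p : P.obj.obj (op A)), θ.app A (q.app _ p) = (unit F P).app A p ≫ k :=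
    fun A p => key _ _ (hq.surj _ _).choose_spec
  refine ⟨B, θ, ?_, ?_⟩
  · intro Z z
    obtain ⟨T, t, z', ht, hz⟩ := exists_strongEpi_pullback k z
    obtain ⟨Z', e, A, x, p, he, hx⟩ := (unit_isLocalIso F P).surj z'
    refine ⟨Z', e ≫ t, A, x, q.app _ p, inferInstance, ?_⟩
    rw [hθ, reassoc_of% hx, Category.assoc, hz]
  · intro Z A c c' x hx
    obtain ⟨p, rfl⟩ := hq.surj _ c
    obtain ⟨p', rfl⟩ := hq.surj _ c'
    rw [hθ, hθ, ← Category.assoc, ← Category.assoc] at hx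
    obtain ⟨l, hl, hl'⟩ := hk.lift' _ _ hx
    obtain ⟨Z₁, e₁, A₁, x₁, r, he₁, hr⟩ := (unit_isLocalIso F R).surj l
    obtain ⟨Z₂, e₂, A₂, f, g, x₂, he₂, hf, hg, hfg⟩ :=
      (unit_isLocalIso F P).inj₂ (s.hom.app _ r) p x₁ (e₁ ≫ x) (by
        rw [← unit_app_map, reassoc_of% hr, hl, Category.assoc])
    obtain ⟨Z₃, e₃, A₃, u, x₃, he₃, hu, huu⟩ :=
      (unit_isLocalIso F P).inj (P.obj.map f.op (t.hom.app _ r)) (P.obj.map g.op p') x₂ (by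
        rw [Family.naturality, Family.naturality, reassoc_of% hf, reassoc_of% hg, ← unit_app_map,
          reassoc_of% hr, hl'])
    refine ⟨Z₃, e₃ ≫ e₂ ≫ e₁, A₃, u ≫ g, x₃, inferInstance, ?_, ?_⟩
    · rw [F.map_comp, reassoc_of% hu, hg, Category.assoc, Category.assoc]
    · have w := ConcreteCategory.congr_hom (congrArg (fun φ => NatTrans.app φ (op A₁)) hq.w) r
      simp only [NatTrans.comp_app, ConcreteCategory.comp_apply] at w
      rw [op_comp, Functor.map_comp_apply, Functor.map_comp_apply,
        ← NatTrans.naturality_apply q g.op,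
        ← NatTrans.naturality_apply q g.op, ← hfg, NatTrans.naturality_apply q f.op, w,
        ← NatTrans.naturality_apply q f.op, ← NatTrans.naturality_apply q u.op,
        ← NatTrans.naturality_apply q u.op, huu]

end Extend

end Realizable

/-! ### Weights that are quotients of representables -/

section Weights

variable {K : Type u₁} [Category.{v₁} K] {A : Type u₂} [Category.{v₂} A]

/-- Let the weight `φ` be the quotient, by `q`, of the representable on `X` by a relation
`s, t : R ⟶ X`. The leg at `q(1_X)` of a cocone weighted by `φ`. -/
def WeightedCocone.leg {φ : Kᵒᵖ ⥤ Type v₁} {D : K ⥤ A} {X : K} (q : yoneda.obj X ⟶ φ)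
    (c : WeightedCocone φ D) : D.obj X ⟶ c.pt :=
  c.ι.app (op ⟨op X, q.app _ (𝟙 X)⟩)

variable {φ : Kᵒᵖ ⥤ Type v₁} {D : K ⥤ A} {R X : K} {s t : R ⟶ X} {q : yoneda.obj X ⟶ φ}

lemma WeightedCocone.map_comp_leg (c : WeightedCocone φ D) {k : K} (x : φ.obj (op k))
    (a : k ⟶ X) (h : q.app _ a = x) : D.map a ≫ c.leg q = c.ι.app (op ⟨op k, x⟩) := by
  have h' : φ.map a.op (q.app _ (𝟙 X)) = x := by
    rw [← NatTrans.naturality_apply, ← h]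
    simp
  exact c.w (CategoryOfElements.homMk ⟨op X, q.app _ (𝟙 X)⟩ ⟨op k, x⟩ a.op h').op

lemma WeightedCocone.condition (hq : IsQuotient (yoneda.map s) (yoneda.map t) q)
    (c : WeightedCocone φ D) : D.map s ≫ c.leg q = D.map t ≫ c.leg q := by
  rw [c.map_comp_leg _ s rfl, c.map_comp_leg _ t]
  have := ConcreteCategory.congr_hom (congrArg (fun f => NatTrans.app f (op R)) hq.w) (𝟙 R)
  simpa using this.symm

/-- A colimit weighted by the quotient of a representable by a relation `s, t` is a coequalizer
of the images of `s` and `t`. -/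
noncomputable def WeightedCocone.isColimitCofork
    (hq : IsQuotient (yoneda.map s) (yoneda.map t) q)
    {c : WeightedCocone φ D} (hc : IsColimit c) :
    IsColimit (Cofork.ofπ (c.leg q) (c.condition hq)) := by
  refine Cofork.IsColimit.ofExistsUnique fun f => ?_
  have key : ∀ {k : K} (a b : k ⟶ X), q.app _ a = q.app _ b →
      D.map a ≫ f.π = D.map b ≫ f.π := by
    intro k a b hab
    obtain ⟨r, hr, hr'⟩ := hq.exists_rel (U := op k) a b hab
    have hr : r ≫ s = a := hr
    have hr' : r ≫ t = b := hr'
    rw [← hr, ← hr', D.map_comp, D.map_comp, Category.assoc, Category.assoc, f.condition]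
  let c' : WeightedCocone φ D :=
    { pt := f.pt
      ι :=
        { app := fun j => D.map (hq.surj _ j.unop.2).choose ≫ f.π
          naturality := by
            rintro ⟨⟨⟨k⟩, x⟩⟩ ⟨⟨⟨k'⟩, x'⟩⟩ ⟨⟨⟨g⟩, hg⟩⟩
            change D.map g ≫ D.map _ ≫ f.π = (D.map _ ≫ f.π) ≫ 𝟙 _
            rw [Category.comp_id, ← Category.assoc, ← D.map_comp]
            apply key
            have h1 := (hq.surj (op k') x').choose_spec
            have h2 := (hq.surj (op k) x).choose_spec
            change φ.map g.op x' = x at hg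
            refine Eq.trans ?_ h2.symm
            rw [← hg]
            refine Eq.trans ?_ (congrArg (φ.map g.op) h1)
            rw [← NatTrans.naturality_apply]
            simp } }
  refine ⟨hc.desc c', ?_, ?_⟩
  · refine (hc.fac c' _).trans ?_
    refine (key _ (𝟙 X) (hq.surj _ _).choose_spec).trans ?_
    simp
  · intro m hm
    refine hc.hom_ext ?_
    rintro ⟨⟨⟨k⟩, x⟩⟩
    rw [hc.fac]
    have h2 := (hq.surj (op k) x).choose_spec
    refine (congrArg (· ≫ m) (c.map_comp_leg _ _ h2).symm).trans
      ((Category.assoc _ _ _).trans ?_)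
    exact congrArg (D.map _ ≫ ·) hm

end Weights

/-! ### The weights of `Φ_reg` and `Φ_ex` -/

section RegEx

lemma isEquivalenceRelation_of_isKernelPair {A : Type u₁} [Category.{v₁} A] [HasPullbacks A]
    {R X Y : A} {f : X ⟶ Y} {s t : R ⟶ X} (h : IsKernelPair f s t) :
    IsEquivalenceRelation s t :=
  (IsKernelPair.equivalenceRelation f s t (pullbackIsPullback t s) h).isEquivalenceRelation

/-- A presentation of a weight as the quotient of a representable by an equivalence relation. -/
structure LexWeight.Presentation (φ : LexWeight.{v}) where
  /-- the object of the relation -/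
  R : φ.K
  /-- the object on which the relation lives -/
  X : φ.K
  /-- the first projection -/
  s : R ⟶ X
  /-- the second projection -/
  t : R ⟶ X
  isEquivalenceRelation : IsEquivalenceRelation s t
  /-- the quotient map -/
  q : yoneda.obj X ⟶ φ.weight
  isQuotient : IsQuotient (yoneda.map s) (yoneda.map t) q

section

variable {K : Type v} [SmallCategory K] [HasFiniteLimits K]

lemma isQuotient_coequalizer_kernelPair {X Y : K} (f : X ⟶ Y) :
    IsQuotient (yoneda.map (pullback.fst f f)) (yoneda.map (pullback.snd f f))
      (coequalizer.π (pullback.fst (yoneda.map f) (yoneda.map f))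
        (pullback.snd (yoneda.map f) (yoneda.map f))) := by
  have h : IsQuotient (pullback.fst (yoneda.map f) (yoneda.map f))
      (pullback.snd (yoneda.map f) (yoneda.map f)) (coequalizer.π _ _) :=
    isQuotient_of_isColimit (isEquivalenceRelation_of_isKernelPair
      (IsKernelPair.of_hasPullback (yoneda.map f)))
      (coequalizer.condition _ _) (coequalizerIsCoequalizer _ _)
  have hk : IsKernelPair (yoneda.map f) (yoneda.map (pullback.fst f f))
    (yoneda.map (pullback.snd f f)) := (IsPullback.of_hasPullback f f).map yoneda
  refine ⟨?_, h.surj, ?_⟩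
  · have h1 := pullback.lift_fst _ _ hk.w
    have h2 := pullback.lift_snd _ _ hk.w
    generalize pullback.lift _ _ hk.w = l at h1 h2
    rw [← h1, ← h2, Category.assoc, Category.assoc, coequalizer.condition]
  · intro U x y hxy
    obtain ⟨r, hr, hr'⟩ := h.exists_rel x y hxy
    refine Types.exists_of_isPullback (hk.app U) x y ?_
    rw [← hr, ← hr']
    have := congrArg (fun φ => NatTrans.app φ U) (pullback.condition
      (f := yoneda.map f) (g := yoneda.map f))
    exact ConcreteCategory.congr_hom this r

lemma isQuotient_coequalizer {R X : K} {s t : R ⟶ X} (h : IsEquivalenceRelation s t) :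
    IsQuotient (yoneda.map s) (yoneda.map t)
      (coequalizer.π (yoneda.map s) (yoneda.map t)) :=
  isQuotient_of_isColimit (isEquivalenceRelation_map yoneda h)
    (coequalizer.condition _ _) (coequalizerIsCoequalizer _ _)

/-- The coequalizer of the kernel pair of `K(-, f)` is the quotient of a representable by the kernel
pair of `f`. -/
noncomputable def LexWeight.Presentation.ofKernelPair {X Y : K} (f : X ⟶ Y) :
    (LexWeight.mk K (coequalizer (pullback.fst (yoneda.map f) (yoneda.map f))
      (pullback.snd (yoneda.map f) (yoneda.map f)))).Presentation where
  R := pullback f f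
  X := X
  s := pullback.fst f f
  t := pullback.snd f f
  isEquivalenceRelation := isEquivalenceRelation_of_isKernelPair (IsKernelPair.of_hasPullback f)
  q := coequalizer.π _ _
  isQuotient := isQuotient_coequalizer_kernelPair f

/-- The coequalizer of `K(-, s)` and `K(-, t)`, for an equivalence relation `s, t` in `K`. -/
noncomputable def LexWeight.Presentation.ofEquivalenceRelation {R X : K} {s t : R ⟶ X}
    (h : IsEquivalenceRelation s t) :
    (LexWeight.mk K (coequalizer (yoneda.map s) (yoneda.map t))).Presentation where
  R := R
  X := X
  s := s
  t := t
  isEquivalenceRelation := h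
  q := coequalizer.π _ _
  isQuotient := isQuotient_coequalizer h

end

/-- The weight of `Φ_reg`, presented by the kernel pair of the generating arrow. -/
noncomputable def regPresentation : regWeight.{v}.Presentation :=
  LexWeight.Presentation.ofKernelPair KReg.f

/-- The weight of `Φ_ex`, presented by the generating equivalence relation. -/
noncomputable def exPresentation (h : IsEquivalenceRelation KEx.s.{v} KEx.t.{v}) :
    exWeight.{v}.Presentation :=
  LexWeight.Presentation.ofEquivalenceRelation h

end RegEx

/-! ### Closure of the realizable presheaves under lex colimits -/

section Closed

variable {C : Type u} [Category.{v} C]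

/-- The realizable presheaves are closed under the lex colimits whose weight is the quotient of a
representable by an equivalence relation which left exact functors to `E` send to a kernel pair. -/
lemma isLexClosed_realizable {E : Type u₂} [Category.{v₂} E] (F : C ⥤ E) [HasFiniteLimits C]
    [Regular E] [PreservesFiniteLimits F] {Φ : Set LexWeight.{v}}
    (hΦ : ∀ φ ∈ Φ, ∃ p : φ.Presentation, ∀ G : φ.K ⥤ E, PreservesFiniteLimits G →
      ∃ (B : E) (k : G.obj p.X ⟶ B), IsKernelPair k (G.map p.s) (G.map p.t)) :
    IsLexClosed Φ C (realizable F) where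
  of_iso := inferInstance
  representable := realizable_yoneda F
  finiteLimit := realizable_limits F
  lexColimit φ hφ D hD hDF c hc := by
    obtain ⟨p, hp⟩ := hΦ φ hφ
    obtain ⟨hc⟩ := hc
    let D' : φ.K ⥤ (realizable F).FullSubcategory := (realizable F).lift D hDF
    have hD' : PreservesFiniteLimits D' := by
      have : PreservesFiniteLimits (D' ⋙ (realizable F).ι) := hD
      exact ⟨fun J _ _ => preservesLimitsOfShape_of_reflects_of_preserves D' (realizable F).ι⟩
    obtain ⟨B, k, hk⟩ := hp (D' ⋙ extend F) inferInstance
    exact realizable_quotient F (s := D'.map p.s) (t := D'.map p.t)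
      (isQuotient_of_isColimit (isEquivalenceRelation_map D p.isEquivalenceRelation) _
        (WeightedCocone.isColimitCofork p.isQuotient hc)) hk

variable (C) in
/-- `Φ C` itself is closed under finite limits and `Φ`-lex-colimits. -/
lemma isLexClosed_lexClosure (Φ : Set LexWeight.{v}) : IsLexClosed Φ C (lexClosure Φ C) where
  of_iso := ⟨fun e hP Q hQ => have := hQ.of_iso; Q.prop_of_iso e (hP Q hQ)⟩
  representable X Q hQ := hQ.representable X
  finiteLimit J _ _ := ⟨fun X hX Q hQ => by
    have := hQ.finiteLimit J
    obtain ⟨h⟩ := hX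
    exact Q.prop_of_isLimit h.isLimit fun j => h.prop_diag_obj j Q hQ⟩
  lexColimit φ hφ D hD hDQ c hc Q hQ := hQ.lexColimit φ hφ D hD (fun k => hDQ k Q hQ) c hc

instance (Φ : Set LexWeight.{v}) : HasFiniteLimits (Completion Φ C) :=
  hasFiniteLimits_fullSubcategory _ (isLexClosed_lexClosure C Φ).finiteLimit

instance (Φ : Set LexWeight.{v}) : PreservesFiniteLimits (lexClosure Φ C).ι :=
  preservesFiniteLimits_ι _ (isLexClosed_lexClosure C Φ).finiteLimit

instance (Φ : Set LexWeight.{v}) : (W Φ C).Full :=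
  have : (W Φ C ⋙ (lexClosure Φ C).ι).Full := inferInstanceAs (yoneda (C := C)).Full
  Functor.Full.of_comp_faithful (W Φ C) (lexClosure Φ C).ι

instance (Φ : Set LexWeight.{v}) : (W Φ C).Faithful :=
  have : (W Φ C ⋙ (lexClosure Φ C).ι).Faithful := inferInstanceAs (yoneda (C := C)).Faithful
  Functor.Faithful.of_comp (W Φ C) (lexClosure Φ C).ι

instance (Φ : Set LexWeight.{v}) : PreservesFiniteLimits (W Φ C) := by
  have : PreservesFiniteLimits (W Φ C ⋙ (lexClosure Φ C).ι) :=
    inferInstanceAs (PreservesFiniteLimits (yoneda (C := C)))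
  exact ⟨fun J _ _ => preservesLimitsOfShape_of_reflects_of_preserves (W Φ C) (lexClosure Φ C).ι⟩

/-- `Φ C` has the quotients of the equivalence relations that are images of the generic ones. -/
lemma exists_isQuotient {Φ : Set LexWeight.{v}} {φ : LexWeight.{v}} (hφ : φ ∈ Φ)
    (p : φ.Presentation) (D : φ.K ⥤ Completion Φ C) (hD : PreservesFiniteLimits D) :
    ∃ (Q : Completion Φ C) (q : D.obj p.X ⟶ Q),
      IsQuotient (D.map p.s).hom (D.map p.t).hom q.hom := by
  let D' := D ⋙ (lexClosure Φ C).ι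
  let c : WeightedCocone φ.weight D' := colimit.cocone _
  have hc : IsColimit c := colimit.isColimit _
  refine ⟨⟨c.pt, (isLexClosed_lexClosure C Φ).lexColimit φ hφ D' inferInstance
    (fun k => (D.obj k).property) c ⟨hc⟩⟩, ObjectProperty.homMk (c.leg p.q), ?_⟩
  exact isQuotient_of_isColimit (isEquivalenceRelation_map D' p.isEquivalenceRelation) _
    (WeightedCocone.isColimitCofork p.isQuotient hc)

end Closed

/-! ### Regularity of `Φ C` -/

section RegularCompletion

lemma regular_of_factorization {A : Type u₁} [Category.{v₁} A] [HasFiniteLimits A]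
    (hf : ∀ {X Y : A} (f : X ⟶ Y), ∃ (I : A) (e : X ⟶ I) (m : I ⟶ Y),
      IsRegularEpi e ∧ Mono m ∧ e ≫ m = f)
    (hs : ∀ {P X Y Z : A} {a : P ⟶ X} {b : P ⟶ Y} {f : X ⟶ Z} {g : Y ⟶ Z},
      IsPullback a b f g → IsRegularEpi g → IsRegularEpi a) : Regular A where
  hasCoequalizer_of_isKernelPair {X Y Z f g₁ g₂} h := by
    obtain ⟨I, e, m, he, hm, rfl⟩ := hf f
    exact ⟨⟨⟨_, h.cancel_right_of_mono.toCoequalizer'⟩⟩⟩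
  regularEpiIsStableUnderBaseChange := ⟨fun h hg => hs h.flip hg⟩

variable {C : Type u} [Category.{v} C]

namespace IsQuotient

variable {R P X T : Cᵒᵖ ⥤ Type w} {s t : R ⟶ P} {q : P ⟶ X}

lemma exists_desc (hq : IsQuotient s t q) (f : P ⟶ T) (hf : s ≫ f = t ≫ f) :
    ∃ g : X ⟶ T, q ≫ g = f := by
  have key : ∀ {U} (x y : P.obj U), q.app U x = q.app U y → f.app U x = f.app U y := by
    intro U x y hxy
    obtain ⟨r, rfl, rfl⟩ := hq.exists_rel x y hxy
    exact ConcreteCategory.congr_hom (congrArg (fun φ => NatTrans.app φ U) hf) r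
  refine ⟨{ app := fun U => ↾fun x => f.app U (hq.surj U x).choose, naturality := ?_ }, ?_⟩
  · intro U V u
    ext x
    refine Eq.trans (b := T.map u (f.app U (hq.surj U x).choose)) ?_ rfl
    refine Eq.trans (b := f.app V (hq.surj V (X.map u x)).choose) rfl ?_
    rw [← NatTrans.naturality_apply]
    apply key
    rw [(hq.surj _ _).choose_spec, NatTrans.naturality_apply, (hq.surj _ _).choose_spec]
  · ext U x
    exact key _ _ (hq.surj _ _).choose_spec

lemma injective_desc (hq : IsQuotient s t q) (g : X ⟶ T) (h : IsKernelPair (q ≫ g) s t) (U) :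
    Function.Injective (g.app U) := by
  intro x y hxy
  obtain ⟨x, rfl⟩ := hq.surj U x
  obtain ⟨y, rfl⟩ := hq.surj U y
  obtain ⟨r, rfl, rfl⟩ := Types.exists_of_isPullback (h.app U) x y hxy
  exact ConcreteCategory.congr_hom (congrArg (fun φ => NatTrans.app φ U) hq.w) r

lemma isKernelPair (hq : IsQuotient s t q) (h : IsEquivalenceRelation s t) :
    IsKernelPair q s t := by
  refine IsPullback.of_forall_isPullback_app fun U => ?_
  obtain ⟨⟨e⟩⟩ := isEquivalenceRelation_map ((evaluation _ _).obj U) h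
  rw [Types.isPullback_iff]
  refine ⟨congrArg (fun φ => NatTrans.app φ U) hq.w, ?_, fun x y hxy => hq.exists_rel x y hxy⟩
  rintro r r' ⟨h1, h2⟩
  exact ConcreteCategory.congr_hom (e.right_cancellation (↾fun _ : PUnit => r) (↾fun _ => r')
    (by ext; exact h1) (by ext; exact h2)) PUnit.unit

lemma of_iso (hq : IsQuotient s t q) {R' P' : Cᵒᵖ ⥤ Type w} {s' t' : R' ⟶ P'} (a : R ≅ R')
    (b : P ≅ P') (hs : s ≫ b.hom = a.hom ≫ s') (ht : t ≫ b.hom = a.hom ≫ t') :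
    IsQuotient s' t' (b.inv ≫ q) where
  w := by
    rw [← cancel_epi a.hom, ← reassoc_of% hs, ← reassoc_of% ht]
    simpa using hq.w
  surj U x := by
    obtain ⟨y, rfl⟩ := hq.surj U x
    exact ⟨b.hom.app U y, by simp⟩
  exists_rel {U} x y hxy := by
    obtain ⟨r, hr, hr'⟩ := hq.exists_rel (b.inv.app U x) (b.inv.app U y) (by simpa using hxy)
    refine ⟨a.hom.app U r, ?_, ?_⟩
    · rw [← NatTrans.comp_app_apply, ← hs, NatTrans.comp_app_apply, hr]
      simp
    · rw [← NatTrans.comp_app_apply, ← ht, NatTrans.comp_app_apply, hr']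
      simp

end IsQuotient

variable {Φ : Set LexWeight.{v}}

namespace Completion

lemma isPullback_hom {P X Y Z : Completion Φ C} {a : P ⟶ X} {b : P ⟶ Y} {f : X ⟶ Z} {g : Y ⟶ Z}
    (h : IsPullback a b f g) : IsPullback a.hom b.hom f.hom g.hom :=
  h.map (lexClosure Φ C).ι

/-- Pointwise surjections are regular epimorphisms in `Φ C`. -/
lemma isRegularEpi_of_surjective {X Y : Completion Φ C} (f : X ⟶ Y)
    (hf : ∀ U, Function.Surjective (f.hom.app U)) : IsRegularEpi f := by
  have : ∀ U, Epi (f.hom.app U) := fun U => (epi_iff_surjective _).2 (hf U)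
  have : Epi f.hom := NatTrans.epi_of_epi_app f.hom
  have : IsRegularEpi f.hom := IsRegularEpiCategory.regularEpiOfEpi f.hom
  have : Epi f := (lexClosure Φ C).ι.epi_of_epi_map (inferInstanceAs (Epi f.hom))
  refine IsRegularEpi.of_epi_of_exists fun T g hg => ?_
  obtain ⟨k, hk⟩ := IsRegularEpi.exists_of_isKernelPair f.hom
    (isPullback_hom (IsPullback.of_hasPullback f f)) g.hom (congrArg InducedCategory.Hom.hom hg)
  exact ⟨ObjectProperty.homMk k, by ext1; exact hk⟩

lemma mono_of_injective {X Y : Completion Φ C} (f : X ⟶ Y)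
    (hf : ∀ U, Function.Injective (f.hom.app U)) : Mono f := by
  have : ∀ U, Mono (f.hom.app U) := fun U => (mono_iff_injective _).2 (hf U)
  exact (lexClosure Φ C).ι.mono_of_mono_map (NatTrans.mono_of_mono_app f.hom)

/-- `Φ C` has image factorizations, computed pointwise. -/
def HasImages (Φ : Set LexWeight.{v}) (C : Type u) [Category.{v} C] : Prop :=
  ∀ {X Y : Completion Φ C} (f : X ⟶ Y), ∃ (I : Completion Φ C) (e : X ⟶ I) (m : I ⟶ Y),
    (∀ U, Function.Surjective (e.hom.app U)) ∧ Mono m ∧ e ≫ m = f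

/-- If the kernel pair of `f` has a quotient in `Φ C`, then it is the image of `f`. -/
lemma exists_image {R X Y Q : Completion Φ C} {f : X ⟶ Y} {s t : R ⟶ X}
    (h : IsKernelPair f s t) {q : X ⟶ Q} (hq : IsQuotient s.hom t.hom q.hom) :
    ∃ (I : Completion Φ C) (e : X ⟶ I) (m : I ⟶ Y),
      (∀ U, Function.Surjective (e.hom.app U)) ∧ Mono m ∧ e ≫ m = f := by
  have h' : IsKernelPair f.hom s.hom t.hom := isPullback_hom h
  obtain ⟨g, hg⟩ := hq.exists_desc f.hom h'.w
  rw [← hg] at h'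
  exact ⟨Q, q, ObjectProperty.homMk g, hq.surj, mono_of_injective _ (hq.injective_desc g h'),
    by ext1; exact hg⟩

/-- Pointwise images force regular epimorphisms to be pointwise surjective, since the monomorphic
part of a regular epimorphism is invertible. -/
lemma surjective_of_isRegularEpi (H : HasImages Φ C) {X Y : Completion Φ C} (f : X ⟶ Y)
    [IsRegularEpi f] (U) : Function.Surjective (f.hom.app U) := by
  obtain ⟨I, e, m, he, hm, rfl⟩ := H f
  have : StrongEpi m := strongEpi_of_strongEpi e m
  have : IsIso m := isIso_of_mono_of_strongEpi m
  have : IsIso m.hom := inferInstanceAs (IsIso ((lexClosure Φ C).ι.map m))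
  have h := (isIso_iff_bijective (m.hom.app U)).1 inferInstance
  exact h.2.comp (he U)

lemma regular (H : HasImages Φ C) : Regular (Completion Φ C) := by
  refine regular_of_factorization (fun f => ?_) ?_
  · obtain ⟨I, e, m, he, hm, h⟩ := H f
    exact ⟨I, e, m, isRegularEpi_of_surjective e he, hm, h⟩
  · intro P X Y Z a b f g h hg
    refine isRegularEpi_of_surjective a fun U x => ?_
    obtain ⟨y, hy⟩ := surjective_of_isRegularEpi H g U (f.hom.app U x)
    obtain ⟨p, hp, -⟩ := Types.exists_of_isPullback ((isPullback_hom h).app U) x y hy.symm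
    exact ⟨p, hp⟩

lemma isBarrExact (H : ∀ {R X : Completion Φ C} (s t : R ⟶ X), IsEquivalenceRelation s t →
    ∃ (Q : Completion Φ C) (q : X ⟶ Q), IsQuotient s.hom t.hom q.hom) :
    IsBarrExact (Completion Φ C) := by
  have h1 : HasImages Φ C := by
    intro X Y f
    obtain ⟨Q, q, hq⟩ :=
      H _ _ (isEquivalenceRelation_of_isKernelPair (IsKernelPair.of_hasPullback f))
    exact exists_image (IsKernelPair.of_hasPullback f) hq
  have := regular h1
  refine { exists_isKernelPair := fun {R X} s t h => ?_ }
  obtain ⟨Q, q, hq⟩ := H s t h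
  have hk : IsKernelPair q.hom s.hom t.hom :=
    hq.isKernelPair (isEquivalenceRelation_map (lexClosure Φ C).ι h)
  exact ⟨Q, q, IsPullback.of_map (lexClosure Φ C).ι (by ext1; exact hk.w) hk⟩

end Completion

end RegularCompletion

/-! ### Left exact reflections of regular and of Barr-exact categories -/

section Reflective

lemma isRegularEpi_map {C : Type u₁} [Category.{v₁} C] {D : Type u₂} [Category.{v₂} D]
    (F : D ⥤ C) [PreservesColimitsOfShape WalkingParallelPair F]
    {X Y : D} (f : X ⟶ Y) [IsRegularEpi f] : IsRegularEpi (F.map f) :=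
  ⟨⟨Cofork.IsColimit.regularEpi
    (isColimitCoforkMapOfIsColimit F (IsRegularEpi.w f) (IsRegularEpi.isColimit f))⟩⟩

variable {C : Type u₁} [Category.{v₁} C] [HasFiniteLimits C] {D : Type u₂} [Category.{v₂} D]
  {W : C ⥤ D} [W.Full] [W.Faithful] {L : D ⥤ C} [PreservesFiniteLimits L]

/-- A left exact reflection of a regular category is regular: factorizations are obtained by
reflecting those of `D`, and stability of regular epimorphisms is inherited from `D`. -/
lemma regular_of_adjunction [Regular D] (adj : L ⊣ W) : Regular C := by
  have hL := adj.leftAdjoint_preservesColimits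
  have hW := adj.rightAdjoint_preservesLimits
  have hε : ∀ {X Y : C} (f : X ⟶ Y),
      inv (adj.counit.app X) ≫ L.map (W.map f) ≫ adj.counit.app Y = f := by
    intro X Y f
    simp
  refine regular_of_factorization (fun {X Y} f => ?_) ?_
  · let S := Regular.strongEpiMonoFactorisation (W.map f)
    have he : IsRegularEpi S.e := inferInstance
    refine ⟨L.obj S.I, inv (adj.counit.app X) ≫ L.map S.e, L.map S.m ≫ adj.counit.app Y, ?_,
      inferInstance, ?_⟩
    · have := isRegularEpi_map L S.e
      exact (MorphismProperty.cancel_left_of_respectsIso (.regularEpi C) _ _).2 this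
    · rw [Category.assoc, ← L.map_comp_assoc, S.fac, hε]
  · intro P X Y Z a b f g h hg
    let S := Regular.strongEpiMonoFactorisation (W.map g)
    have he : IsRegularEpi S.e := inferInstance
    -- the reflection of the monomorphic part of `W g` is an isomorphism, as `g` is a strong epi
    have hm : IsIso (L.map S.m) := by
      have h1 : (inv (adj.counit.app Y) ≫ L.map S.e) ≫ L.map S.m ≫ adj.counit.app Z = g := by
        rw [Category.assoc, ← L.map_comp_assoc, S.fac, hε]
      have : StrongEpi ((inv (adj.counit.app Y) ≫ L.map S.e) ≫ L.map S.m ≫ adj.counit.app Z) := by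
        rw [h1]; infer_instance
      have := strongEpi_of_strongEpi (inv (adj.counit.app Y) ≫ L.map S.e)
        (L.map S.m ≫ adj.counit.app Z)
      have := isIso_of_mono_of_strongEpi (L.map S.m ≫ adj.counit.app Z)
      exact IsIso.of_isIso_comp_right (L.map S.m) (adj.counit.app Z)
    have hp := IsPullback.of_hasPullback (W.map f) S.m
    have hWP : IsPullback (W.map a) (W.map b) (W.map f) (S.e ≫ S.m) := by
      rw [S.fac]; exact h.map W
    have hp' := IsPullback.of_bot' hWP.flip hp.flip
    have hl := hp.flip.lift_snd (W.map b ≫ S.e) (W.map a) (by simpa using hWP.flip.w)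
    generalize hp.flip.lift (W.map b ≫ S.e) (W.map a) _ = l at hp' hl
    have hle : IsRegularEpi l := Regular.regularEpiIsStableUnderBaseChange.of_isPullback hp' he
    have hm' : IsIso (L.map (pullback.fst (W.map f) S.m)) := (hp.map L).isIso_fst_of_isIso
    rw [← hε a, ← hl, L.map_comp, Category.assoc]
    refine (MorphismProperty.cancel_left_of_respectsIso (.regularEpi C) _ _).2 ?_
    refine (MorphismProperty.cancel_right_of_respectsIso (.regularEpi C) _ _).2 ?_
    exact isRegularEpi_map L l

/-- An equivalence relation in the reflective subcategory is the kernel pair of the reflection of a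
map of which it is the kernel pair in `D`. -/
lemma isBarrExact_of_adjunction (hD : IsBarrExact D) (adj : L ⊣ W) : IsBarrExact C := by
  have := hD.toRegular
  have hW := adj.rightAdjoint_preservesLimits
  have := regular_of_adjunction adj
  refine { exists_isKernelPair := fun {R X} s t h => ?_ }
  obtain ⟨Y, q, hq⟩ := hD.exists_isKernelPair _ _ (isEquivalenceRelation_map W h)
  refine ⟨L.obj Y, inv (adj.counit.app X) ≫ L.map q, ?_⟩
  exact (hq.map L).of_iso (asIso (adj.counit.app R)) (asIso (adj.counit.app X))
    (asIso (adj.counit.app X)) (Iso.refl _) (by simp) (by simp) (by simp) (by simp)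

end Reflective

/-! ### Left exact functors determined by finitely many generators -/

section Generators

/-- A functor to types preserves finite limits if each finite family of elements of its values comes
from a single element at which no two maps out of it agree. (Such a functor is a
filtered union of representables.) -/
lemma preservesFiniteLimits_of_elements {K : Type u₁} [Category.{v₁} K] (h : K ⥤ Type w)
    (H : ∀ (ι : Type) [Finite ι] (A : ι → K) (a : ∀ i, h.obj (A i)), ∃ (T : K) (t : h.obj T),
      (∀ {Y : K} (u v : T ⟶ Y), h.map u t = h.map v t → u = v) ∧
        ∀ i, ∃ u : T ⟶ A i, h.map u t = a i) : PreservesFiniteLimits h where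
  preservesFiniteLimits J _ _ := by
    refine ⟨fun {d} => ⟨fun {c} hc => ?_⟩⟩
    rw [Types.isLimit_iff]
    intro x hx
    obtain ⟨T, t, ht, hu⟩ := H J d.obj x
    choose u hu using hu
    let s : Cone d :=
      { pt := T
        π := { app := u
               naturality := fun j j' f => by
                refine (Category.id_comp _).trans (ht _ _ ?_)
                rw [h.map_comp_apply, hu, hu]
                exact (hx f).symm } }
    refine ⟨h.map (hc.lift s) t, fun j => ?_, fun y hy => ?_⟩
    · change h.map (c.π.app j) (h.map (hc.lift s) t) = x j
      rw [← h.map_comp_apply, hc.fac, hu]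
    · obtain ⟨T', t', ht', hu'⟩ := H Bool (fun _ => c.pt) (fun b => cond b y (h.map (hc.lift s) t))
      obtain ⟨u₁, h₁⟩ := hu' true
      obtain ⟨u₂, h₂⟩ := hu' false
      change h.map u₁ t' = y at h₁
      change h.map u₂ t' = h.map (hc.lift s) t at h₂
      suffices u₁ = u₂ by rw [← h₁, ← h₂, this]
      refine hc.hom_ext fun j => ht' _ _ ?_
      rw [h.map_comp_apply, h.map_comp_apply, h₁, h₂, ← h.map_comp_apply, hc.fac, hu]
      exact hy j

/-- Preservation of finite limits by a functor to presheaves is checked pointwise. -/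
lemma preservesFiniteLimits_of_evaluation {D : Type u₂} [Category.{v₂} D]
    {K : Type v} [SmallCategory K] (H : K ⥤ Dᵒᵖ ⥤ Type w)
    (h : ∀ Z, PreservesFiniteLimits (H ⋙ (evaluation _ _).obj Z)) : PreservesFiniteLimits H :=
  ⟨fun J _ _ => preservesLimitsOfShape_of_evaluation H J fun _ => inferInstance⟩

variable {K : Type v} [SmallCategory K] {ι : Type} (i : ι → K)

/-- The objects `i g` form a codense full subcategory: each object `A` is the limit of the diagram
of its maps to them. -/
def IsCodense : Prop :=
  ∀ (A T : K) (x : ∀ g, (A ⟶ i g) → (T ⟶ i g)),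
    (∀ {g g'} (e : A ⟶ i g) (m : i g ⟶ i g'), x g' (e ≫ m) = x g e ≫ m) →
      ∃! l : T ⟶ A, ∀ g e, l ≫ e = x g e

variable {i}

/-- The shape of the canonical diagram of generators under an object. -/
@[simps]
def IsCodense.shape (i : ι → K) (A : K) : MulticospanShape.{v, v} where
  L := Σ g, (A ⟶ i g)
  R := Σ (g g' : ι), (A ⟶ i g) × (i g ⟶ i g')
  fst r := ⟨r.1, r.2.2.1⟩
  snd r := ⟨r.2.1, r.2.2.1 ≫ r.2.2.2⟩

/-- The canonical diagram of generators under an object. -/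
@[simps]
def IsCodense.index (i : ι → K) (A : K) : MulticospanIndex (IsCodense.shape i A) K where
  left a := i a.1
  right r := i r.2.1
  fst r := r.2.2.2
  snd _ := 𝟙 _

/-- The canonical cone over the diagram of generators under an object. -/
def IsCodense.multifork (i : ι → K) (A : K) : Multifork (IsCodense.index i A) :=
  Multifork.ofι _ A (fun a => a.2)
    (fun r => (Category.comp_id (r.2.2.1 ≫ r.2.2.2)).symm)

lemma IsCodense.isLimit (hi : IsCodense i) (A : K) :
    Nonempty (IsLimit (IsCodense.multifork i A)) := by
  have key : ∀ s : Multifork (IsCodense.index i A), ∃! l : s.pt ⟶ A,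
      ∀ g e, l ≫ e = s.ι ⟨g, e⟩ := by
    intro s
    refine hi A s.pt (fun g e => s.ι ⟨g, e⟩) ?_
    intro g g' e m
    exact ((s.condition ⟨g, g', e, m⟩).trans (Category.comp_id _)).symm
  exact ⟨Multifork.IsLimit.mk _ (fun s => (key s).choose)
    (fun s a => (key s).choose_spec.1 a.1 a.2)
    (fun s m hm => (key s).choose_spec.2 m fun g e => hm ⟨g, e⟩)⟩

variable [Finite ι] [∀ A B : K, Finite (A ⟶ B)]

/-- A left exact functor preserves the canonical limits. -/
lemma IsCodense.isLimit_map (hi : IsCodense i) {D : Type u₂} [Category.{v₂} D] (G : K ⥤ D)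
    [PreservesFiniteLimits G] (A : K) :
    Nonempty (IsLimit (G.mapCone (IsCodense.multifork i A))) := by
  classical
  have : Fintype (IsCodense.shape i A).L := by
    have := Fintype.ofFinite ι
    have (g : ι) := Fintype.ofFinite (A ⟶ i g)
    exact inferInstanceAs (Fintype (Σ g, (A ⟶ i g)))
  have : Fintype (IsCodense.shape i A).R := by
    have := Fintype.ofFinite ι
    have (A B : K) := Fintype.ofFinite (A ⟶ B)
    exact inferInstanceAs (Fintype (Σ (g g' : ι), (A ⟶ i g) × (i g ⟶ i g')))
  exact ⟨isLimitOfPreserves G (hi.isLimit A).some⟩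

lemma IsCodense.existsUnique_lift (hi : IsCodense i) {D : Type u₂} [Category.{v₂} D] (G : K ⥤ D)
    [PreservesFiniteLimits G] {A : K} {Z : D} (x : ∀ g, (A ⟶ i g) → (Z ⟶ G.obj (i g)))
    (hx : ∀ {g g'} (e : A ⟶ i g) (m : i g ⟶ i g'), x g' (e ≫ m) = x g e ≫ G.map m) :
    ∃! l : Z ⟶ G.obj A, ∀ g e, l ≫ G.map e = x g e := by
  obtain ⟨hl⟩ := hi.isLimit_map G A
  let s : Cone ((IsCodense.index i A).multicospan ⋙ G) :=
    { pt := Z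
      π :=
        { app := fun j => match j with
            | .left a => x a.1 a.2
            | .right r => x r.2.1 (r.2.2.1 ≫ r.2.2.2)
          naturality := by
            rintro _ _ (_ | r | r)
            · simp
            · exact (Category.id_comp _).trans (hx r.2.2.1 r.2.2.2)
            · exact (Category.id_comp _).trans ((Category.comp_id _).symm.trans
                (congrArg (x _ _ ≫ ·) (G.map_id _).symm)) } }
  refine ⟨hl.lift s, fun g e => hl.fac s (.left ⟨g, e⟩), fun m hm => hl.hom_ext ?_⟩
  rintro (⟨g, e⟩ | r)
  · rw [hl.fac]
    exact hm g e
  · rw [hl.fac]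
    have h := (IsCodense.multifork i A).w (WalkingMulticospan.Hom.snd r)
    refine (congrArg (m ≫ ·) (congrArg G.map h.symm)).trans ?_
    exact (congrArg (m ≫ G.map ·) (Category.comp_id _)).trans
      (hm r.2.1 (r.2.2.1 ≫ r.2.2.2))

/-- Transformations between left exact functors are determined by their restriction to a codense
family of objects. -/
lemma IsCodense.existsUnique_natTrans (hi : IsCodense i) {D : Type u₂} [Category.{v₂} D]
    (F G : K ⥤ D) [PreservesFiniteLimits G] (α : ∀ g, F.obj (i g) ⟶ G.obj (i g))
    (hα : ∀ {g g'} (m : i g ⟶ i g'), F.map m ≫ α g' = α g ≫ G.map m) :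
    ∃! τ : F ⟶ G, ∀ g, τ.app (i g) = α g := by
  have key (A : K) := hi.existsUnique_lift G (A := A) (Z := F.obj A)
    (fun g e => F.map e ≫ α g) (fun e m => by rw [F.map_comp, Category.assoc, hα, Category.assoc])
  choose τ hτ hτ' using key
  refine ⟨⟨τ, ?_⟩, ?_, ?_⟩
  · intro A B f
    refine (hi.existsUnique_lift G (fun g e => F.map (f ≫ e) ≫ α g) ?_).unique ?_ ?_
    · intro g g' e m
      rw [← Category.assoc f e m, F.map_comp _ m, Category.assoc, hα, Category.assoc]
    · intro g e
      rw [Category.assoc, hτ, F.map_comp, Category.assoc]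
    · intro g e
      rw [Category.assoc, ← G.map_comp, hτ]
  · intro g
    exact (hτ' (i g) (α g) fun g' e => (hα e).symm).symm
  · intro σ hσ
    ext A
    refine hτ' A _ fun g e => ?_
    rw [← σ.naturality, hσ]

/-- A left exact functor to presheaves on `D` whose values at a codense family of objects are
representable comes from a left exact functor to `D`. -/
lemma IsCodense.exists_functor (hi : IsCodense i) {D : Type u₂} [Category.{v₂} D]
    [HasFiniteLimits D] (H : K ⥤ Dᵒᵖ ⥤ Type v₂) [PreservesFiniteLimits H] (B : ι → D)
    (ρ : ∀ g, H.obj (i g) ≅ yoneda.obj (B g)) :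
    ∃ (F : K ⥤ D) (_ : PreservesFiniteLimits F) (σ : ∀ g, F.obj (i g) ≅ B g),
      ∀ {g g'} (e : i g ⟶ i g') (m : B g ⟶ B g'),
        H.map e ≫ (ρ g').hom = (ρ g).hom ≫ yoneda.map m →
          F.map e ≫ (σ g').hom = (σ g).hom ≫ m := by
  have hH : ∀ A, (yoneda (C := D)).essImage (H.obj A) := by
    intro A
    obtain ⟨hl⟩ := hi.isLimit_map H A
    classical
    have : Fintype (IsCodense.shape i A).L := by
      have := Fintype.ofFinite ι
      have (g : ι) := Fintype.ofFinite (A ⟶ i g)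
      exact inferInstanceAs (Fintype (Σ g, (A ⟶ i g)))
    have : Fintype (IsCodense.shape i A).R := by
      have := Fintype.ofFinite ι
      have (A B : K) := Fintype.ofFinite (A ⟶ B)
      exact inferInstanceAs (Fintype (Σ (g g' : ι), (A ⟶ i g) × (i g ⟶ i g')))
    refine (yoneda (C := D)).essImage.prop_of_isLimit hl ?_
    rintro (a | r)
    · exact ⟨_, ⟨(ρ _).symm⟩⟩
    · exact ⟨_, ⟨(ρ _).symm⟩⟩
  let F := Functor.essImage.liftFunctor H yoneda hH
  let e : F ⋙ yoneda ≅ H := Functor.essImage.liftFunctorCompIso H yoneda hH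
  have hF : PreservesFiniteLimits F := by
    have : PreservesFiniteLimits (F ⋙ yoneda) := preservesFiniteLimits_of_natIso e.symm
    exact ⟨fun J _ _ => preservesLimitsOfShape_of_reflects_of_preserves F yoneda⟩
  refine ⟨F, hF, fun g => yoneda.preimageIso (e.app (i g) ≪≫ ρ g), ?_⟩
  intro g g' f m hm
  apply yoneda.map_injective
  have := e.hom.naturality f
  simp only [Functor.comp_map] at this
  simp [reassoc_of% this, hm]

end Generators

/-! ### The free category with finite limits on an equivalence relation -/

section FreeEquivalenceRelation

namespace FinSetoid

instance (A B : FinSetoid.{v}) : Finite (A ⟶ B) :=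
  Finite.of_injective (β := ULift.{v} (Fin A.carrier.len) → ULift.{v} (Fin B.carrier.len))
    (fun f => f.map) fun _ _ h => hom_ext h

instance (A B : KEx.{v}) : Finite (A ⟶ B) :=
  Finite.of_injective (fun f => f.unop) fun _ _ h => Quiver.Hom.unop_inj h

/-- The map from the one-element setoid selecting an element. -/
def homOne {A : FinSetoid.{v}} (a : ULift.{v} (Fin A.carrier.len)) : one.{v} ⟶ A :=
  (⟨fun _ => a, fun _ _ _ => A.rel.refl _⟩ : Hom one.{v} A)

/-- The map from the two-element setoid selecting a pair of equivalent elements. -/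
def homTwo {A : FinSetoid.{v}} {a b : ULift.{v} (Fin A.carrier.len)} (h : A.rel a b) :
    two.{v} ⟶ A :=
  (⟨fun i => ![a, b] i.down, fun i j _ => by
    obtain ⟨i⟩ := i
    obtain ⟨j⟩ := j
    change Fin 2 at i j
    change A.rel (![a, b] i) (![a, b] j)
    fin_cases i <;> fin_cases j
    exacts [A.rel.refl _, h, A.rel.symm h, A.rel.refl _]⟩ : Hom two.{v} A)

lemma point_zero_homTwo {A : FinSetoid.{v}} {a b : ULift.{v} (Fin A.carrier.len)}
    (h : A.rel a b) : point 0 ≫ homTwo h = homOne a := rfl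

lemma point_one_homTwo {A : FinSetoid.{v}} {a b : ULift.{v} (Fin A.carrier.len)}
    (h : A.rel a b) : point 1 ≫ homTwo h = homOne b := rfl

lemma homOne_map {A : FinSetoid.{v}} (e : one ⟶ A) : homOne (e.map (ULift.up (0 : Fin 1))) = e := by
  refine hom_ext (funext fun i => ?_)
  have : i = ULift.up (0 : Fin 1) := by
    obtain ⟨i⟩ := i
    exact congrArg ULift.up (Subsingleton.elim (α := Fin 1) _ _)
  rw [this]
  rfl

lemma hom_ext_two {A : FinSetoid.{v}} {e e' : two ⟶ A} (h₀ : point 0 ≫ e = point 0 ≫ e')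
    (h₁ : point 1 ≫ e = point 1 ≫ e') : e = e' := by
  refine hom_ext (funext fun i => ?_)
  obtain ⟨i⟩ := i
  change Fin 2 at i
  fin_cases i
  · exact congrFun (congrArg Hom.map h₀) (ULift.up (0 : Fin 1))
  · exact congrFun (congrArg Hom.map h₁) (ULift.up (0 : Fin 1))

lemma eq_point (e : one.{v} ⟶ two.{v}) : e = point 0 ∨ e = point 1 := by
  rw [← homOne_map e]
  obtain ⟨i⟩ := e.map (ULift.up (0 : Fin 1))
  change Fin 2 at i
  fin_cases i
  · exact .inl rfl
  · exact .inr rfl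

lemma eq_id (e : one.{v} ⟶ one.{v}) : e = 𝟙 _ := by
  refine hom_ext (funext fun i => ?_)
  exact ULift.ext _ _ (Subsingleton.elim (α := Fin 1) _ _)

end FinSetoid

open FinSetoid

/-- The axioms of an equivalence relation hold because the maps of finite setoids out of `two`
are the pairs of equivalent elements, and those out of `one` are the elements. -/
lemma isEquivalenceRelation_KEx : IsEquivalenceRelation KEx.s.{v} KEx.t.{v} := by
  have hr (A : FinSetoid.{v}) (e : two ⟶ A) :
      A.rel (e.map (ULift.up (0 : Fin 2))) (e.map (ULift.up (1 : Fin 2))) :=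
    e.map_rel _ _ trivial
  let c := pullback.cone KEx.t.{v} KEx.s.{v}
  have hc : point 1 ≫ c.fst.unop = point 0 ≫ c.snd.unop :=
    congrArg Quiver.Hom.unop c.condition
  have h₁ : c.pt.unop.rel (c.fst.unop.map (ULift.up (0 : Fin 2)))
      (c.snd.unop.map (ULift.up (1 : Fin 2))) := by
    refine c.pt.unop.rel.trans (hr _ c.fst.unop) ?_
    have : c.fst.unop.map (ULift.up (1 : Fin 2)) = c.snd.unop.map (ULift.up (0 : Fin 2)) :=
      congrFun (congrArg Hom.map hc) (ULift.up (0 : Fin 1))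
    rw [this]
    exact hr _ c.snd.unop
  refine ⟨⟨?_⟩⟩
  exact
    { right_cancellation := fun A a b h h' =>
        Quiver.Hom.unop_inj (hom_ext_two (congrArg Quiver.Hom.unop h)
          (congrArg Quiver.Hom.unop h'))
      r := (homTwo (A := one) (a := ULift.up (0 : Fin 1)) (b := ULift.up (0 : Fin 1))
        trivial).op
      reflexivity₁ := Quiver.Hom.unop_inj (eq_id _)
      reflexivity₂ := Quiver.Hom.unop_inj (eq_id _)
      s := (homTwo (A := two) (a := ULift.up (1 : Fin 2)) (b := ULift.up (0 : Fin 2))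
        trivial).op
      symmetry₁ := rfl
      symmetry₂ := rfl
      c := c
      isLimit := pullback.isLimit _ _
      t := (homTwo h₁).op
      transitivity₁ := rfl
      transitivity₂ := rfl }

/-- The two objects of the generating equivalence relation. -/
def KEx.generator (g : Bool) : KEx.{v} := cond g (op one) (op two)

lemma KEx.isCodense_generator : IsCodense KEx.generator.{v} := by
  intro A T x hx
  let x₁ (e : one ⟶ A.unop) : one ⟶ T.unop := (x true e.op).unop
  let x₂ (e : two ⟶ A.unop) : two ⟶ T.unop := (x false e.op).unop
  have h₁₂ (i : Fin 2) (e : two ⟶ A.unop) : x₁ (point i ≫ e) = point i ≫ x₂ e :=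
    congrArg Quiver.Hom.unop (hx (g := false) (g' := true) e.op (point i).op)
  let l : A.unop ⟶ T.unop :=
    (⟨fun a => (x₁ (homOne a)).map (ULift.up (0 : Fin 1)), fun a b h => by
      have h' := (x₂ (homTwo h)).map_rel (ULift.up (0 : Fin 2)) (ULift.up (1 : Fin 2)) trivial
      have h₀ := h₁₂ 0 (homTwo h)
      have h₁ := h₁₂ 1 (homTwo h)
      rw [point_zero_homTwo] at h₀
      rw [point_one_homTwo] at h₁
      rw [h₀, h₁]
      exact h'⟩ : Hom A.unop T.unop)
  have hl (e : one ⟶ A.unop) : e ≫ l = x₁ e := by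
    rw [← homOne_map e, ← homOne_map (x₁ _)]
    rfl
  refine ⟨l.op, ?_, ?_⟩
  · rintro (_ | _) e
    · refine Quiver.Hom.unop_inj (hom_ext_two ?_ ?_)
      · exact (hl (point 0 ≫ e.unop)).trans (h₁₂ 0 e.unop)
      · exact (hl (point 1 ≫ e.unop)).trans (h₁₂ 1 e.unop)
    · exact Quiver.Hom.unop_inj (hl e.unop)
  · intro m hm
    refine Quiver.Hom.unop_inj (hom_ext (funext fun a => ?_))
    exact congrFun (congrArg Hom.map (congrArg Quiver.Hom.unop (hm true (homOne a).op)))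
      (ULift.up (0 : Fin 1))

/-- The tuples of elements of a setoid, indexed by a finite setoid and preserving the relation. -/
def FinSetoid.points (M : Type w) (r : Setoid M) : KEx.{v} ⥤ Type w where
  obj A := {x : Fin A.unop.carrier.len → M //
    ∀ i j, A.unop.rel (ULift.up i) (ULift.up j) → r (x i) (x j)}
  map f := ↾fun x => ⟨fun i => x.1 (f.unop.map (ULift.up i)).down,
    fun i j h => x.2 _ _ (f.unop.map_rel _ _ h)⟩

/-- A finite subset of a setoid is itself the image of a finite setoid. -/
lemma FinSetoid.exists_of_finite {M : Type w} (r : Setoid M) (S : Set M) (hS : S.Finite) :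
    ∃ (T : FinSetoid.{v}) (x : Fin T.carrier.len → M), Function.Injective x ∧
      (∀ i j, T.rel (ULift.up i) (ULift.up j) ↔ r (x i) (x j)) ∧ ∀ m ∈ S, ∃ i, x i = m := by
  have := hS.to_subtype
  obtain ⟨n, ⟨e⟩⟩ := Finite.exists_equiv_fin S
  let x : Fin n → M := fun i => (e.symm i : M)
  refine ⟨⟨FintypeCat.Skeleton.mk n, Setoid.comap (fun i => x i.down) r⟩, x,
    Subtype.val_injective.comp e.symm.injective, fun i j => Iff.rfl, fun m hm => ⟨e ⟨m, hm⟩, ?_⟩⟩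
  simp [x]

lemma FinSetoid.preservesFiniteLimits_points (M : Type w) (r : Setoid M) :
    PreservesFiniteLimits (FinSetoid.points.{v} M r) := by
  refine preservesFiniteLimits_of_elements _ fun ι _ A a => ?_
  obtain ⟨T, x, hx, hr, hS⟩ := FinSetoid.exists_of_finite.{v} r (⋃ i, Set.range (a i).1)
    (Set.finite_iUnion fun i => Set.finite_range _)
  refine ⟨op T, ⟨x, fun i j => (hr i j).1⟩, ?_, fun i => ?_⟩
  · intro Y u v huv
    refine Quiver.Hom.unop_inj (hom_ext (funext fun k => ULift.ext _ _ (hx ?_)))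
    exact congrFun (congrArg Subtype.val huv) k.down
  · choose u hu using fun k => hS ((a i).1 k) (Set.mem_iUnion.2 ⟨i, k, rfl⟩)
    refine ⟨Quiver.Hom.op (Y := T) (⟨fun k => ULift.up (u k.down), fun k l h => ?_⟩ :
      Hom (A i).unop T), Subtype.ext (funext hu)⟩
    rw [hr, hu, hu]
    exact (a i).2 _ _ h

section

variable {D : Type u₂} [Category.{v₂} D] [HasFiniteLimits D] {S U : D} {p q : S ⟶ U}

/-- The equivalence relation on generalized elements given by an internal equivalence relation. -/
def relHom (h : IsEquivalenceRelation p q) (Z : D) : Setoid (Z ⟶ U) where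
  r x y := ∃ z : Z ⟶ S, z ≫ p = x ∧ z ≫ q = y
  iseqv := by
    obtain ⟨⟨e⟩⟩ := isEquivalenceRelation_map (coyoneda.obj (op Z)) h
    exact TypeCat.equivalence_of_equivalenceRelation e

/-- The presheaves of finite tuples of generalized elements preserving a relation. -/
def relPoints (h : IsEquivalenceRelation p q) : KEx.{v} ⥤ Dᵒᵖ ⥤ Type v₂ where
  obj A :=
    { obj := fun Z => (FinSetoid.points _ (relHom h Z.unop)).obj A
      map := fun f => ↾fun x => ⟨fun i => f.unop ≫ x.1 i, fun i j hij => by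
        obtain ⟨z, h₁, h₂⟩ := x.2 i j hij
        exact ⟨f.unop ≫ z, by rw [Category.assoc, h₁], by rw [Category.assoc, h₂]⟩⟩
      map_id := fun Z => by
        ext x
        exact Subtype.ext (funext fun i => Category.id_comp _)
      map_comp := fun f g => by
        ext x
        exact Subtype.ext (funext fun i => Category.assoc _ _ _) }
  map f := { app := fun Z => (FinSetoid.points _ (relHom h Z.unop)).map f }

/-- Tuples indexed by `one` are generalized elements of `U`. -/
def relPointsOne (h : IsEquivalenceRelation p q) :
    (relPoints.{v} h).obj (op one) ≅ yoneda.obj U :=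
  NatIso.ofComponents (fun Z => Equiv.toIso
    { toFun := fun x => x.1 (0 : Fin 1)
      invFun := fun x => ⟨fun _ => x, fun _ _ _ => (relHom h Z.unop).refl _⟩
      left_inv := fun x => Subtype.ext (funext fun i =>
        congrArg x.1 (Subsingleton.elim (α := Fin 1) _ _))
      right_inv := fun x => rfl })

/-- Tuples indexed by `two` are generalized elements of the relation. -/
noncomputable def relPointsTwo (h : IsEquivalenceRelation p q) :
    (relPoints.{v} h).obj (op two) ≅ yoneda.obj S := by
  refine (NatIso.ofComponents (fun Z => Equiv.toIso (Equiv.ofBijective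
    (fun z : Z.unop ⟶ S => (⟨![z ≫ p, z ≫ q], ?_⟩ :
      (FinSetoid.points.{v} _ (relHom h Z.unop)).obj (op two))) ⟨?_, ?_⟩)) ?_).symm
  · have hz : relHom h Z.unop (z ≫ p) (z ≫ q) := ⟨z, rfl, rfl⟩
    intro i j _
    change Fin 2 at i j
    fin_cases i <;> fin_cases j
    exacts [(relHom h Z.unop).refl _, hz, (relHom h Z.unop).symm hz, (relHom h Z.unop).refl _]
  · intro z z' hz
    obtain ⟨⟨e⟩⟩ := h
    have hz' := congrArg Subtype.val hz
    exact e.right_cancellation _ _ (congrFun hz' (0 : Fin 2)) (congrFun hz' (1 : Fin 2))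
  · intro x
    obtain ⟨z, h₁, h₂⟩ := x.2 (0 : Fin 2) (1 : Fin 2) trivial
    refine ⟨z, Subtype.ext (funext fun i => ?_)⟩
    change Fin 2 at i
    fin_cases i
    exacts [h₁, h₂]
  · intro Z Z' f
    ext z
    refine Subtype.ext (funext fun i => ?_)
    change Fin 2 at i
    fin_cases i
    exacts [Category.assoc _ _ _, Category.assoc _ _ _]

instance (h : IsEquivalenceRelation p q) : PreservesFiniteLimits (relPoints.{v} h) :=
  preservesFiniteLimits_of_evaluation _ fun Z =>
    FinSetoid.preservesFiniteLimits_points _ (relHom h Z.unop)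

end

lemma isFreeLexOnEquivalenceRelation_KEx :
    IsFreeLexOnEquivalenceRelation.{v, v, v₂, u₂} KEx.s.{v} KEx.t.{v} where
  isEquivalenceRelation := isEquivalenceRelation_KEx
  exists_functor D _ _ S U p q h := by
    let ρ (g : Bool) : (relPoints.{v} h).obj (KEx.generator g) ≅ yoneda.obj (cond g U S) :=
      match g with
      | true => relPointsOne h
      | false => relPointsTwo h
    obtain ⟨F, hF, σ, hσ⟩ := KEx.isCodense_generator.exists_functor (relPoints.{v} h)
      (fun g => cond g U S) ρ
    refine ⟨F, hF, σ false, σ true, hσ (g := false) (g' := true) KEx.s p ?_,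
      hσ (g := false) (g' := true) KEx.t q ?_⟩
    · rw [← Iso.inv_comp_eq]
      rfl
    · rw [← Iso.inv_comp_eq]
      rfl
  existsUnique_hom D _ _ F G hF hG a b hs ht := by
    let α (g : Bool) : F.obj (KEx.generator g) ⟶ G.obj (KEx.generator g) :=
      match g with
      | true => b
      | false => a
    have h₁ {g : Bool} (m : KEx.generator.{v} g ⟶ op one) : F.map m ≫ b = α g ≫ G.map m := by
      cases g with
      | true =>
        obtain rfl : m = 𝟙 (op one) := Quiver.Hom.unop_inj (eq_id m.unop)
        exact (congrArg (· ≫ b) (F.map_id (op one))).trans ((Category.id_comp b).trans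
          ((Category.comp_id b).symm.trans (congrArg (b ≫ ·) (G.map_id (op one)).symm)))
      | false =>
        obtain h | h := eq_point m.unop
        · obtain rfl : m = KEx.s := Quiver.Hom.unop_inj h
          exact hs
        · obtain rfl : m = KEx.t := Quiver.Hom.unop_inj h
          exact ht
    obtain ⟨τ, hτ, hτ'⟩ := KEx.isCodense_generator.existsUnique_natTrans F G α (by
      rintro g (_ | _) m
      · change KEx.generator g ⟶ op two at m
        obtain ⟨⟨e⟩⟩ := isEquivalenceRelation_map G isEquivalenceRelation_KEx.{v}
        change F.map m ≫ a = α g ≫ G.map m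
        refine e.right_cancellation _ _ ?_ ?_
        · rw [Category.assoc, ← hs, ← F.map_comp_assoc, Category.assoc, ← G.map_comp]
          exact h₁ _
        · rw [Category.assoc, ← ht, ← F.map_comp_assoc, Category.assoc, ← G.map_comp]
          exact h₁ _
      · exact h₁ m)
    refine ⟨τ, ⟨hτ false, hτ true⟩, fun τ' h => hτ' τ' ?_⟩
    rintro (_ | _)
    exacts [h.1, h.2]

end FreeEquivalenceRelation

/-! ### The free category with finite limits on an arrow -/

section FreeArrow

namespace KReg

instance (A B : Arrow FintypeCat.Skeleton.{v}) : Finite (A ⟶ B) :=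
  Finite.of_injective (β := (ULift.{v} (Fin A.left.len) → ULift.{v} (Fin B.left.len)) ×
    (ULift.{v} (Fin A.right.len) → ULift.{v} (Fin B.right.len)))
    (fun f => (f.left, f.right))
    fun _ _ h => Arrow.hom_ext _ _ (congrArg Prod.fst h) (congrArg Prod.snd h)

instance (A B : KReg.{v}) : Finite (A ⟶ B) :=
  Finite.of_injective (fun f => f.unop) fun _ _ h => Quiver.Hom.unop_inj h

lemma skeleton_one_hom_ext {n : FintypeCat.Skeleton.{v}}
    {f g : FintypeCat.Skeleton.mk.{v} 1 ⟶ n}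
    (h : f (ULift.up (0 : Fin 1)) = g (ULift.up (0 : Fin 1))) : f = g := by
  refine funext fun i => ?_
  have : i = ULift.up (0 : Fin 1) := by
    obtain ⟨i⟩ := i
    exact congrArg ULift.up (Subsingleton.elim (α := Fin 1) _ _)
  rw [this]
  exact h

lemma skeleton_zero_hom_ext {n : FintypeCat.Skeleton.{v}}
    {f g : FintypeCat.Skeleton.mk.{v} 0 ⟶ n} : f = g :=
  funext fun i => Fin.elim0 i.down

lemma hom_apply {A B : Arrow FintypeCat.Skeleton.{v}} (f : A ⟶ B)
    (a : ULift.{v} (Fin A.left.len)) : B.hom (f.left a) = f.right (A.hom a) :=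
  congrFun (Arrow.w f) a

/-- The map `1 ⟶ 1` mapped to a map of finite sets, by selecting an element of its domain. -/
def homX {A : Arrow FintypeCat.Skeleton.{v}} (a : ULift.{v} (Fin A.left.len)) :
    Arrow.mk (𝟙 (FintypeCat.Skeleton.mk.{v} 1)) ⟶ A :=
  Arrow.homMk (fun _ => a) (fun _ => A.hom a) rfl

/-- The map `0 ⟶ 1` mapped to a map of finite sets, by selecting an element of its codomain. -/
def homY {A : Arrow FintypeCat.Skeleton.{v}} (b : ULift.{v} (Fin A.right.len)) :
    Arrow.mk emptyToOne.{v} ⟶ A :=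
  Arrow.homMk (fun i => Fin.elim0 i.down) (fun _ => b) skeleton_zero_hom_ext

lemma homX_ext {A : Arrow FintypeCat.Skeleton.{v}}
    {e e' : Arrow.mk (𝟙 (FintypeCat.Skeleton.mk.{v} 1)) ⟶ A}
    (h : e.left (ULift.up (0 : Fin 1)) = e'.left (ULift.up (0 : Fin 1))) : e = e' := by
  refine Arrow.hom_ext _ _ (skeleton_one_hom_ext h) (skeleton_one_hom_ext ?_)
  exact (hom_apply e (ULift.up (0 : Fin 1))).symm.trans
    ((congrArg A.hom h).trans (hom_apply e' (ULift.up (0 : Fin 1))))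

lemma homY_ext {A : Arrow FintypeCat.Skeleton.{v}} {e e' : Arrow.mk emptyToOne.{v} ⟶ A}
    (h : e.right (ULift.up (0 : Fin 1)) = e'.right (ULift.up (0 : Fin 1))) : e = e' :=
  Arrow.hom_ext _ _ skeleton_zero_hom_ext (skeleton_one_hom_ext h)

/-- The two objects of the generating arrow. -/
def generator (g : Bool) : KReg.{v} := cond g X Y

lemma isCodense_generator : IsCodense generator.{v} := by
  intro A T x hx
  let x₁ (e : X.{v}.unop ⟶ A.unop) : X.{v}.unop ⟶ T.unop := (x true e.op).unop
  let x₂ (e : Y.{v}.unop ⟶ A.unop) : Y.{v}.unop ⟶ T.unop := (x false e.op).unop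
  have h₁₂ (e : X.{v}.unop ⟶ A.unop) : x₂ (f.unop ≫ e) = f.unop ≫ x₁ e :=
    congrArg Quiver.Hom.unop (hx (g := true) (g' := false) e.op f)
  let l : A.unop ⟶ T.unop :=
    Arrow.homMk (fun a => (x₁ (homX a)).left (ULift.up (0 : Fin 1)))
      (fun b => (x₂ (homY b)).right (ULift.up (0 : Fin 1))) (by
        refine funext fun a => ?_
        change T.unop.hom ((x₁ (homX a)).left (ULift.up (0 : Fin 1))) =
          (x₂ (homY (A.unop.hom a))).right (ULift.up (0 : Fin 1))
        have h : homY (A.unop.hom a) = f.unop ≫ homX a := homY_ext rfl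
        rw [h, h₁₂]
        exact hom_apply (x₁ (homX a)) (ULift.up (0 : Fin 1)))
  refine ⟨l.op, ?_, ?_⟩
  · rintro (_ | _) e
    · refine Quiver.Hom.unop_inj (homY_ext ?_)
      have h : homY (e.unop.right (ULift.up (0 : Fin 1))) = e.unop := homY_ext rfl
      exact congrArg (fun e' => (x₂ e').right (ULift.up (0 : Fin 1))) h
    · refine Quiver.Hom.unop_inj (homX_ext ?_)
      have h : homX (e.unop.left (ULift.up (0 : Fin 1))) = e.unop := homX_ext rfl
      exact congrArg (fun e' => (x₁ e').left (ULift.up (0 : Fin 1))) h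
  · intro m hm
    refine Quiver.Hom.unop_inj (Arrow.hom_ext _ _ (funext fun a => ?_) (funext fun b => ?_))
    · exact congrFun (congrArg (fun e => e.left)
        (congrArg Quiver.Hom.unop (hm true (homX a).op))) (ULift.up (0 : Fin 1))
    · exact congrFun (congrArg (fun e => e.right)
        (congrArg Quiver.Hom.unop (hm false (homY b).op))) (ULift.up (0 : Fin 1))

/-- The maps from maps of finite sets to a map of sets. -/
def points {M N : Type w} (φ : M → N) : KReg.{v} ⥤ Type w where
  obj A := {x : (Fin A.unop.left.len → M) × (Fin A.unop.right.len → N) //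
    ∀ i, φ (x.1 i) = x.2 (A.unop.hom (ULift.up i)).down}
  map {A B} f := ↾fun x => ⟨(fun i => x.1.1 (f.unop.left (ULift.up i)).down,
    fun i => x.1.2 (f.unop.right (ULift.up i)).down), fun i =>
      (x.2 _).trans (congrArg (fun b => x.1.2 (ULift.down b)) (hom_apply f.unop (ULift.up i)))⟩

lemma preservesFiniteLimits_points {M N : Type w} (φ : M → N) :
    PreservesFiniteLimits (points.{v} φ) := by
  refine preservesFiniteLimits_of_elements _ fun ι _ A a => ?_
  -- The map of finite sets is the restriction of `φ` to all the elements that occur.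
  let S : Set M := ⋃ i, Set.range (a i).1.1
  let S' : Set N := (φ '' S) ∪ ⋃ i, Set.range (a i).1.2
  have hS : S.Finite := Set.finite_iUnion fun i => Set.finite_range _
  have hS' : S'.Finite := (hS.image φ).union (Set.finite_iUnion fun i => Set.finite_range _)
  have := hS.to_subtype
  have := hS'.to_subtype
  obtain ⟨n, ⟨e⟩⟩ := Finite.exists_equiv_fin S
  obtain ⟨n', ⟨e'⟩⟩ := Finite.exists_equiv_fin S'
  let ψ : FintypeCat.Skeleton.mk.{v} n ⟶ FintypeCat.Skeleton.mk.{v} n' := fun i =>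
    ULift.up (e' ⟨φ (e.symm i.down), Or.inl (Set.mem_image_of_mem _ (e.symm i.down).2)⟩)
  let t : (points.{v} φ).obj (op (Arrow.mk ψ)) :=
    ⟨(fun i => (e.symm i : M), fun i => (e'.symm i : N)), fun i => by simp [ψ]⟩
  refine ⟨op (Arrow.mk ψ), t, ?_, fun i => ?_⟩
  · intro Y u v huv
    refine Quiver.Hom.unop_inj (Arrow.hom_ext _ _ (funext fun k => ULift.ext _ _ ?_)
      (funext fun k => ULift.ext _ _ ?_))
    · exact e.symm.injective (Subtype.ext
        (congrFun (congrArg (fun z => z.1.1) huv) k.down))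
    · exact e'.symm.injective (Subtype.ext
        (congrFun (congrArg (fun z => z.1.2) huv) k.down))
  · let u : (A i).unop ⟶ Arrow.mk ψ := Arrow.homMk
      (fun k => ULift.up (e ⟨(a i).1.1 k.down, Set.mem_iUnion.2 ⟨i, k.down, rfl⟩⟩))
      (fun k => ULift.up (e' ⟨(a i).1.2 k.down, Or.inr (Set.mem_iUnion.2 ⟨i, k.down, rfl⟩)⟩)) (by
        refine funext fun k => ULift.ext _ _ (e'.symm.injective (Subtype.ext ?_))
        change (e'.symm (e' _) : N) = (e'.symm (e' _) : N)
        rw [Equiv.symm_apply_apply, Equiv.symm_apply_apply, Equiv.symm_apply_apply]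
        exact (a i).2 k.down)
    refine ⟨u.op, Subtype.ext (Prod.ext (funext fun k => ?_) (funext fun k => ?_))⟩
    · change (e.symm (e _) : M) = _
      rw [Equiv.symm_apply_apply]
    · change (e'.symm (e' _) : N) = _
      rw [Equiv.symm_apply_apply]

section

variable {D : Type u₂} [Category.{v₂} D] {U V : D} (h : U ⟶ V)

/-- The presheaves of maps from maps of finite sets to the map induced by `h` on generalized
elements. -/
def arrowPoints : KReg.{v} ⥤ Dᵒᵖ ⥤ Type v₂ where
  obj A :=
    { obj := fun Z => (points (fun x : Z.unop ⟶ U => x ≫ h)).obj A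
      map := fun f => ↾fun x => ⟨(fun i => f.unop ≫ x.1.1 i, fun i => f.unop ≫ x.1.2 i),
        fun i => (Category.assoc _ _ _).trans (congrArg (f.unop ≫ ·) (x.2 i))⟩
      map_id := fun Z => by
        ext x
        exact Subtype.ext (Prod.ext (funext fun i => Category.id_comp _)
          (funext fun i => Category.id_comp _))
      map_comp := fun f g => by
        ext x
        exact Subtype.ext (Prod.ext (funext fun i => Category.assoc _ _ _)
          (funext fun i => Category.assoc _ _ _)) }
  map f := { app := fun Z => (points (fun x : Z.unop ⟶ U => x ≫ h)).map f }

/-- Maps from `1 ⟶ 1` are generalized elements of the domain. -/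
def arrowPointsX : (arrowPoints.{v} h).obj X ≅ yoneda.obj U :=
  NatIso.ofComponents (fun Z => Equiv.toIso
    { toFun := fun x => x.1.1 (0 : Fin 1)
      invFun := fun x => ⟨(fun _ => x, fun _ => x ≫ h), fun _ => rfl⟩
      left_inv := fun x => Subtype.ext (by
        have h₁ : (fun _ => x.1.1 (0 : Fin 1)) = x.1.1 := funext fun i =>
          congrArg x.1.1 (Subsingleton.elim (α := Fin 1) _ _)
        refine Prod.ext h₁ (funext fun i => (x.2 (0 : Fin 1)).trans ?_)
        exact congrArg x.1.2 (Subsingleton.elim (α := Fin 1) _ _))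
      right_inv := fun x => rfl })

/-- Maps from `0 ⟶ 1` are generalized elements of the codomain. -/
def arrowPointsY : (arrowPoints.{v} h).obj Y ≅ yoneda.obj V :=
  NatIso.ofComponents (fun Z => Equiv.toIso
    { toFun := fun x => x.1.2 (0 : Fin 1)
      invFun := fun y => ⟨(fun i => Fin.elim0 i, fun _ => y), fun i => Fin.elim0 i⟩
      left_inv := fun x => Subtype.ext (Prod.ext (funext fun i => Fin.elim0 i)
        (funext fun i => congrArg x.1.2 (Subsingleton.elim (α := Fin 1) _ _)))
      right_inv := fun x => rfl })

instance : PreservesFiniteLimits (arrowPoints.{v} h) :=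
  preservesFiniteLimits_of_evaluation _ fun Z =>
    preservesFiniteLimits_points (fun x : Z.unop ⟶ U => x ≫ h)

end

end KReg

open KReg

lemma isFreeLexOnArrow_KReg : IsFreeLexOnArrow.{v, v, v₂, u₂} KReg.f.{v} where
  exists_functor D _ _ U V h := by
    let ρ (g : Bool) : (arrowPoints.{v} h).obj (generator g) ≅ yoneda.obj (cond g U V) :=
      match g with
      | true => arrowPointsX h
      | false => arrowPointsY h
    obtain ⟨F, hF, σ, hσ⟩ := isCodense_generator.exists_functor (arrowPoints.{v} h)
      (fun g => cond g U V) ρ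
    refine ⟨F, hF, σ true, σ false, hσ (g := true) (g' := false) KReg.f h ?_⟩
    rw [← Iso.inv_comp_eq]
    rfl
  existsUnique_hom D _ _ F G hF hG a b hab := by
    let α (g : Bool) : F.obj (generator g) ⟶ G.obj (generator g) :=
      match g with
      | true => a
      | false => b
    have h_id (Z : KReg.{v}) (c : F.obj Z ⟶ G.obj Z) : F.map (𝟙 Z) ≫ c = c ≫ G.map (𝟙 Z) := by
      simp
    obtain ⟨τ, hτ, hτ'⟩ := isCodense_generator.existsUnique_natTrans F G α (by
      rintro (_ | _) (_ | _) m
      · obtain rfl : m = 𝟙 Y := Quiver.Hom.unop_inj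
          (homY_ext (ULift.ext _ _ (Subsingleton.elim (α := Fin 1) _ _)))
        exact h_id _ b
      · exact Fin.elim0 (m.unop.left (ULift.up (0 : Fin 1))).down
      · obtain rfl : m = KReg.f := Quiver.Hom.unop_inj
          (homY_ext (ULift.ext _ _ (Subsingleton.elim (α := Fin 1) _ _)))
        exact hab
      · obtain rfl : m = 𝟙 X := Quiver.Hom.unop_inj
          (homX_ext (ULift.ext _ _ (Subsingleton.elim (α := Fin 1) _ _)))
        exact h_id _ a)
    refine ⟨τ, ⟨hτ true, hτ false⟩, fun τ' h => hτ' τ' ?_⟩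
    rintro (_ | _)
    exacts [h.2, h.1]

end FreeArrow

/-! ### Quotients in the completions -/

section Quotients

variable {C : Type u} [Category.{v} C]

lemma Completion.surjective_of_isIso {Φ : Set LexWeight.{v}} {X Y : Completion Φ C} (f : X ⟶ Y)
    [IsIso f] (U) : Function.Surjective (f.hom.app U) := by
  have : IsIso f.hom := inferInstanceAs (IsIso ((lexClosure Φ C).ι.map f))
  exact ((isIso_iff_bijective (f.hom.app U)).1 inferInstance).2

variable (C) in
/-- The image of a map is the quotient of its kernel pair, which is the image of the generic kernel
pair under a left exact functor. -/
lemma hasImages_PhiReg : Completion.HasImages PhiReg.{v} C := by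
  intro X Y f
  obtain ⟨F, hF, a, b, hab⟩ := isFreeLexOnArrow_KReg.exists_functor (Completion PhiReg.{v} C) f
  obtain ⟨Q, q, hq⟩ := exists_isQuotient (C := C) (Set.mem_singleton _) regPresentation.{v} F hF
  obtain ⟨I, e, m, he, hm, h⟩ :=
    Completion.exists_image ((IsKernelPair.of_hasPullback KReg.f.{v}).map F) hq
  refine ⟨I, a.inv ≫ e, m ≫ b.hom, fun U => ?_, inferInstance, ?_⟩
  · exact (he U).comp (Completion.surjective_of_isIso a.inv U)
  · rw [Category.assoc, reassoc_of% h, hab, Iso.inv_hom_id_assoc]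

lemma exists_isQuotient_PhiEx {R X : Completion PhiEx.{v} C} (s t : R ⟶ X)
    (h : IsEquivalenceRelation s t) :
    ∃ (Q : Completion PhiEx.{v} C) (q : X ⟶ Q), IsQuotient s.hom t.hom q.hom := by
  obtain ⟨F, hF, a, b, hs, ht⟩ :=
    isFreeLexOnEquivalenceRelation_KEx.exists_functor (Completion PhiEx.{v} C) s t h
  obtain ⟨Q, q, hq⟩ := exists_isQuotient (C := C) (Set.mem_singleton _)
    (exPresentation.{v} isEquivalenceRelation_KEx) F hF
  exact ⟨Q, b.inv ≫ q, hq.of_iso ((lexClosure _ C).ι.mapIso a) ((lexClosure _ C).ι.mapIso b)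
    (congrArg InducedCategory.Hom.hom hs) (congrArg InducedCategory.Hom.hom ht)⟩

variable (C) in
lemma hasImages_PhiEx : Completion.HasImages PhiEx.{v} C := by
  intro X Y f
  obtain ⟨Q, q, hq⟩ := exists_isQuotient_PhiEx _ _
    (isEquivalenceRelation_of_isKernelPair (IsKernelPair.of_hasPullback f))
  exact Completion.exists_image (IsKernelPair.of_hasPullback f) hq

variable (C) in
lemma isBarrExact_PhiEx : IsBarrExact (Completion PhiEx.{v} C) :=
  Completion.isBarrExact exists_isQuotient_PhiEx

variable [HasFiniteLimits C] {E : Type u₂} [Category.{v₂} E] (F : C ⥤ E) [PreservesFiniteLimits F]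

lemma lexClosure_PhiReg_le_realizable [Regular E] : lexClosure PhiReg.{v} C ≤ realizable F :=
  fun P hP => hP _ (isLexClosed_realizable F fun φ hφ => by
    obtain rfl := hφ
    exact ⟨regPresentation, fun G hG =>
      ⟨_, G.map KReg.f, (IsKernelPair.of_hasPullback KReg.f.{v}).map G⟩⟩)

lemma lexClosure_PhiEx_le_realizable (hE : IsBarrExact E) :
    lexClosure PhiEx.{v} C ≤ realizable F :=
  have := hE.toRegular
  fun P hP => hP _ (isLexClosed_realizable F fun φ hφ => by
    obtain rfl := hφ
    exact ⟨exPresentation isEquivalenceRelation_KEx, fun G hG =>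
      hE.exists_isKernelPair _ _ (isEquivalenceRelation_map G isEquivalenceRelation_KEx)⟩)

end Quotients

/-! ### Extension of left exact functors along `W` -/

section Extension

variable {C : Type u} [Category.{v} C] [HasFiniteLimits C] {Φ : Set LexWeight.{v}}
  {E : Type u₂} [Category.{v₂} E] [Regular E] {F : C ⥤ E} [PreservesFiniteLimits F]
  (hF : lexClosure Φ C ≤ realizable F)

/-- The extension along `W` of a left exact functor on `C` for which all objects of `Φ C` are
realizable. -/
noncomputable abbrev Completion.extend : Completion Φ C ⥤ E :=
  ObjectProperty.ιOfLE hF ⋙ LexCol.extend F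

instance : PreservesFiniteLimits (Completion.extend hF) := by
  have : PreservesFiniteLimits (ObjectProperty.ιOfLE hF) := by
    have : PreservesFiniteLimits (ObjectProperty.ιOfLE hF ⋙ (realizable F).ι) :=
      inferInstanceAs (PreservesFiniteLimits (lexClosure Φ C).ι)
    exact ⟨fun J _ _ =>
      preservesLimitsOfShape_of_reflects_of_preserves (ObjectProperty.ιOfLE hF) (realizable F).ι⟩
  infer_instance

/-- The extension of `F` restricts to `F` along `W`. -/
lemma Completion.nonempty_W_comp_extend_iso : Nonempty (W Φ C ⋙ Completion.extend hF ≅ F) := by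
  let V (A : C) : (realizable F).FullSubcategory := (ObjectProperty.ιOfLE hF).obj ((W Φ C).obj A)
  have key (A : C) := (unit_isLocalIso F (V A)).exists_desc (Family.ofYoneda F A)
  choose g hg using key
  have hg' (A X : C) (p : X ⟶ A) : (unit F (V A)).app X p ≫ g A = F.map p :=
    congrArg (fun φ : Family F (yoneda.obj A) (F.obj A) => φ.app X p) (hg A)
  have (A : C) : IsIso (g A) :=
    (unit_isLocalIso F (V A)).isIso_of_comp _ (by rw [hg]; exact Family.isLocalIso_ofYoneda A)
  refine ⟨NatIso.ofComponents (fun A => asIso (g A)) fun {A B} f => ?_⟩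
  refine (unit_isLocalIso F (V A)).hom_ext ?_
  refine Family.ext (funext fun X => funext fun p => ?_)
  change X ⟶ A at p
  have h := unit_app_map_assoc F ((ObjectProperty.ιOfLE hF).map ((W Φ C).map f)) X p (g B)
  change (unit F (V A)).app X p ≫ _ ≫ g B = (unit F (V A)).app X p ≫ g A ≫ F.map f
  refine h.trans ?_
  rw [← Category.assoc, hg', ← F.map_comp]
  exact hg' B X (p ≫ f)

lemma Completion.isRegularEpi_extend_map (hΦ : Completion.HasImages Φ C) {P Q : Completion Φ C}
    (f : P ⟶ Q) [IsRegularEpi f] : IsRegularEpi ((Completion.extend hF).map f) := by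
  have : StrongEpi ((Completion.extend hF).map f) :=
    strongEpi_extend_map F ((ObjectProperty.ιOfLE hF).map f)
      (Completion.surjective_of_isRegularEpi hΦ f)
  exact isRegularEpi_of_strongEpi _

end Extension

section LeftAdjoint

variable {C : Type u} [Category.{v} C] [Regular C] {Φ : Set LexWeight.{v}}
  (hC : lexClosure Φ C ≤ realizable (𝟭 C))

/-- Maps out of the extension of the identity functor are natural families, hence maps into
presheaves represented by objects of `C`. -/
noncomputable def Completion.homEquiv (P : Completion Φ C) (B : C) :
    ((Completion.extend hC).obj P ⟶ B) ≃ (P ⟶ (W Φ C).obj B) :=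
  Equiv.ofBijective
    (fun g => ObjectProperty.homMk
      { app := fun U => ↾fun p => (unit (𝟭 C) ((ObjectProperty.ιOfLE hC).obj P)).app U.unop p ≫ g
        naturality := fun U V f => by
          ext p
          have := (unit (𝟭 C) ((ObjectProperty.ιOfLE hC).obj P)).naturality f.unop p
          exact (congrArg (· ≫ g) this).trans (Category.assoc _ _ _) })
    ⟨fun g g' h => (unit_isLocalIso (𝟭 C) ((ObjectProperty.ιOfLE hC).obj P)).hom_ext (by
        ext X p
        exact ConcreteCategory.congr_hom
          (congrArg (fun φ => NatTrans.app (InducedCategory.Hom.hom φ) (op X)) h) p),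
      fun φ => by
        let θ : Family (𝟭 C) P.obj B :=
          { app := fun X p => φ.hom.app (op X) p
            naturality := fun f p => NatTrans.naturality_apply φ.hom f.op p }
        obtain ⟨g, hg⟩ :=
          (unit_isLocalIso (𝟭 C) ((ObjectProperty.ιOfLE hC).obj P)).exists_desc θ
        refine ⟨g, ?_⟩
        ext U p
        exact congrArg (fun ψ : Family (𝟭 C) P.obj B => ψ.app U.unop p) hg⟩

/-- The extension of the identity functor is left adjoint to `W`. -/
noncomputable def Completion.adjunction : Completion.extend hC ⊣ W Φ C :=
  Adjunction.mkOfHomEquiv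
    { homEquiv := Completion.homEquiv hC
      homEquiv_naturality_left_symm := fun {P P' B} f φ => by
        obtain ⟨g, rfl⟩ := (Completion.homEquiv hC P' B).surjective φ
        rw [Equiv.symm_apply_eq, Equiv.symm_apply_apply]
        ext U p
        exact (unit_app_map_assoc (𝟭 C) ((ObjectProperty.ιOfLE hC).map f) U.unop p g).symm
      homEquiv_naturality_right := fun {P B B'} f g => by
        ext U p
        exact (Category.assoc _ _ _).symm }

/-- The left adjoint is left exact, being an extension to realizable presheaves. -/
lemma isPhiExact_of_le_realizable (hC : lexClosure Φ C ≤ realizable (𝟭 C)) : IsPhiExact Φ C :=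
  ⟨Completion.extend hC, ⟨Completion.adjunction hC⟩, inferInstance⟩

end LeftAdjoint

/-! ### Exact functors on the ex/lex completion -/

section Restriction

/-- Every object of the completion is covered by a representable. -/
lemma exists_cover {C : Type u} [Category.{v} C] [HasFiniteLimits C]
    (P : Completion PhiEx.{v} C) :
    ∃ (A : C) (p : P.obj.obj (op A)), ∀ (B : C) (y : P.obj.obj (op B)),
      ∃ f : B ⟶ A, P.obj.map f.op p = y := by
  have := (isBarrExact_PhiEx C).toRegular
  -- `P` is realized by an object `B` of the completion; the resulting map of presheaves from `P`
  -- to `B` is bijective because surjections onto representables split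
  obtain ⟨B, θ, hθ⟩ := lexClosure_PhiEx_le_realizable (W PhiEx.{v} C) (isBarrExact_PhiEx C)
    _ P.property
  have hsurj {X Y : Completion PhiEx.{v} C} (e : X ⟶ Y) (he : StrongEpi e) (U) :
      Function.Surjective (e.hom.app U) := by
    have := isRegularEpi_of_strongEpi e
    exact Completion.surjective_of_isRegularEpi (hasImages_PhiEx C) e U
  have hinj {X : C} (p p' : P.obj.obj (op X)) (h : θ.app X p = θ.app X p') : p = p' := by
    obtain ⟨Z, e, X', f, x, he, hx, hp⟩ := hθ.inj p p' (𝟙 _) (by rw [h])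
    rw [Category.comp_id] at hx
    obtain ⟨z, hz⟩ := hsurj e he (op X) (𝟙 X)
    have hz' : (show X ⟶ X' from x.hom.app (op X) z) ≫ f = 𝟙 X := by
      rw [← hz, ← hx]
      rfl
    rw [← P.obj.map_id_apply (op X) p, ← P.obj.map_id_apply (op X) p', ← op_id, ← hz', op_comp,
      Functor.map_comp_apply, Functor.map_comp_apply, hp]
  obtain ⟨A, p, hp⟩ := hθ.exists_cover
  refine ⟨A, p, fun Y y => ?_⟩
  obtain ⟨f, hf⟩ := hsurj _ hp (op Y) ((θ.app Y y).hom.app (op Y) (𝟙 Y))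
  change Y ⟶ A at f
  refine ⟨f, hinj _ _ ?_⟩
  rw [θ.naturality]
  ext1
  refine yonedaEquiv.injective (Eq.trans ?_ hf)
  exact congrArg (fun f : Y ⟶ A => (θ.app A p).hom.app (op Y) f) (Category.id_comp f)

/-- If every object of `D` is covered by an object of `C`, and the objects of `C` are projective
with respect to these covers, then a transformation between functors on `D` preserving finite limits
and regular epimorphisms is determined by its restriction to `C`, which may be arbitrary. -/
lemma existsUnique_whiskerLeft_eq {C : Type u} [Category.{v} C] {D : Type u₁} [Category.{v₁} D]
    [HasFiniteLimits D] {E : Type u₂} [Category.{v₂} E] (W : C ⥤ D) [W.Full]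
    (hW : ∀ P : D, ∃ (A : C) (e : W.obj A ⟶ P), IsRegularEpi e ∧
      ∀ (B : C) (x : W.obj B ⟶ P), ∃ f : B ⟶ A, W.map f ≫ e = x)
    (G H : D ⥤ E) [PreservesFiniteLimits G]
    (hG : ∀ ⦃X Y : D⦄ (f : X ⟶ Y), IsRegularEpi f → IsRegularEpi (G.map f))
    (τ : W ⋙ G ⟶ W ⋙ H) : ∃! σ : G ⟶ H, Functor.whiskerLeft W σ = τ := by
  have hτ {A B : C} (x : W.obj B ⟶ W.obj A) : G.map x ≫ τ.app A = τ.app B ≫ H.map x := by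
    obtain ⟨f, rfl⟩ := W.map_surjective x
    exact τ.naturality f
  choose A e he hlift using hW
  have hGe (P : D) : IsRegularEpi (G.map (e P)) := hG _ (he P)
  have hdesc (P : D) : ∃ σ : G.obj P ⟶ H.obj P, G.map (e P) ≫ σ = τ.app (A P) ≫ H.map (e P) := by
    have hk := IsKernelPair.of_hasPullback (e P)
    refine IsRegularEpi.exists_of_isKernelPair (G.map (e P)) (hk.map G) _ ?_
    rw [← cancel_epi (G.map (e (pullback (e P) (e P)))), ← G.map_comp_assoc, ← G.map_comp_assoc,
      reassoc_of% hτ, reassoc_of% hτ, ← H.map_comp, ← H.map_comp, Category.assoc, Category.assoc,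
      hk.w]
  choose σ hσ using hdesc
  have hσ' {P : D} {B : C} (x : W.obj B ⟶ P) : G.map x ≫ σ P = τ.app B ≫ H.map x := by
    obtain ⟨f, rfl⟩ := hlift P B x
    rw [G.map_comp, Category.assoc, hσ, reassoc_of% hτ, H.map_comp]
  refine ⟨{ app := σ, naturality := fun P Q g => ?_ }, ?_, fun σ' h => ?_⟩
  · rw [← cancel_epi (G.map (e P)), ← G.map_comp_assoc, hσ', reassoc_of% hσ, H.map_comp]
  · ext B
    simpa using hσ' (𝟙 (W.obj B))
  · ext P
    rw [← cancel_epi (G.map (e P)), hσ, σ'.naturality, ← h]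
    rfl

lemma isExLexCompletion_W (C : Type u) [Category.{v} C] [HasFiniteLimits C] :
    IsExLexCompletion.{v, u, max u v, max u (v + 1), v₂, u₂} (W PhiEx.{v} C) := by
  refine ⟨isBarrExact_PhiEx C, inferInstance, fun E _ hE => ?_⟩
  have := hE.toRegular
  have hW (P : Completion PhiEx.{v} C) : ∃ (A : C) (e : (W PhiEx.{v} C).obj A ⟶ P),
      IsRegularEpi e ∧ ∀ (B : C) (x : (W PhiEx.{v} C).obj B ⟶ P),
        ∃ f : B ⟶ A, (W PhiEx.{v} C).map f ≫ e = x := by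
    obtain ⟨A, p, hp⟩ := exists_cover P
    refine ⟨A, ObjectProperty.homMk (yonedaEquiv.symm p),
      Completion.isRegularEpi_of_surjective _ fun U y => hp U.unop y, fun B x => ?_⟩
    obtain ⟨f, hf⟩ := hp B (yonedaEquiv x.hom)
    refine ⟨f, ?_⟩
    ext1
    refine yonedaEquiv.injective (Eq.trans ?_ hf)
    exact congrArg (fun f : B ⟶ A => P.obj.map f.op p) (Category.id_comp f)
  have hff (G G' : (exactFunctorBarr (Completion PhiEx.{v} C) E).FullSubcategory)
      (τ : W PhiEx.{v} C ⋙ G.obj ⟶ W PhiEx.{v} C ⋙ G'.obj) :=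
    have := G.property.1
    existsUnique_whiskerLeft_eq (W PhiEx.{v} C) hW G.obj G'.obj G.property.2 τ
  refine { faithful := ⟨fun {G G'} σ σ' h => ?_⟩, full := ⟨fun {G G'} τ => ?_⟩,
           essSurj := ⟨fun F => ?_⟩ }
  · ext1
    exact (hff G G' _).unique rfl (congrArg InducedCategory.Hom.hom h).symm
  · obtain ⟨σ, hσ, -⟩ := hff G G' τ.hom
    exact ⟨ObjectProperty.homMk σ, by ext1; exact hσ⟩
  · have := F.property
    have hF := lexClosure_PhiEx_le_realizable F.obj hE
    obtain ⟨i⟩ := Completion.nonempty_W_comp_extend_iso hF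
    exact ⟨⟨Completion.extend hF, inferInstance, fun X Y f _ =>
      Completion.isRegularEpi_extend_map hF (hasImages_PhiEx C) f⟩, ⟨ObjectProperty.isoMk _ i⟩⟩

end Restriction

end LexCol

theorem mainTheorem7 :
    -- `KReg` and `KEx` are the free categories with finite limits generated by an arrow and by an
    -- equivalence relation, respectively
    LexCol.IsFreeLexOnArrow.{v, v, v₂, u₂} LexCol.KReg.f.{v} ∧
    LexCol.IsFreeLexOnEquivalenceRelation.{v, v, v₂, u₂} LexCol.KEx.s.{v} LexCol.KEx.t.{v} ∧
    ∀ (C : Type u) [Category.{v} C] [HasFiniteLimits C],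
      (LexCol.IsPhiExact LexCol.PhiReg.{v} C ↔ Regular C) ∧
      (LexCol.IsPhiExact LexCol.PhiEx.{v} C ↔ LexCol.IsBarrExact C) ∧
      LexCol.IsExLexCompletion.{v, u, max u v, max u (v + 1), v₂, u₂}
        (LexCol.W LexCol.PhiEx.{v} C) := by
  refine ⟨LexCol.isFreeLexOnArrow_KReg, LexCol.isFreeLexOnEquivalenceRelation_KEx,
    fun C _ _ => ⟨⟨?_, fun h => ?_⟩, ⟨?_, fun h => ?_⟩, LexCol.isExLexCompletion_W C⟩⟩
  · rintro ⟨L, ⟨adj⟩, hL⟩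
    have := LexCol.Completion.regular (LexCol.hasImages_PhiReg C)
    exact LexCol.regular_of_adjunction adj
  · exact LexCol.isPhiExact_of_le_realizable (LexCol.lexClosure_PhiReg_le_realizable (𝟭 C))
  · rintro ⟨L, ⟨adj⟩, hL⟩
    exact LexCol.isBarrExact_of_adjunction (LexCol.isBarrExact_PhiEx C) adj
  · have := h.toRegular
    exact LexCol.isPhiExact_of_le_realizable (LexCol.lexClosure_PhiEx_le_realizable (𝟭 C) h)
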